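/- Conventions. Let $g,d\ge 1$ be integers. All matrices are complex, $\mathcal M_n^{\mathrm{sa}}$ is the set of self-adjoint $n\times n$ matrices, $\|\cdot\|$ is the operator norm, $\le$ between matrices is the positive semidefinite order, and $\mathbf s.\mathbf X=(s_1X_1,\dots,s_gX_g)$. *Inclusion constants.* The matrix cube is $\mathcal D_{\square,g}(n)=\{\mathbf X\in(\mathcal M_n^{\mathrm{sa}})^g:\|X_i\|\le 1\ \forall i\}$. For $\mathbf B\in(\mathcal M_d^{\mathrm{sa}})^g$ let $\mathcal D_{\mathbf B}(n)=\{\mathbf X\in(\mathcal M_n^{\mathrm{sa}})^g:\sum_i B_i\otimes X_i\le I\}$. Then $\Delta_\square(g,d)$ is the set of $\mathbf s\in[0,1]^g$ such that, for all $\mathbf B\in(\mathcal M_d^{\mathrm{sa}})^g$, $\mathcal D_{\square,g}(1)\subseteq\mathcal D_{\mathbf B}(1)$ implies $\mathbf s.\mathcal D_{\square,g}(n)\subseteq\mathcal D_{\mathbf B}(n)$ for all $n$. *Steering.* An assemblage is a family $(\sigma_{a|x})_{a\in\{\pm\},\,x\in[g]}$ of positive semidefinite $d\times d$ matrices such that $\sigma_{+|x}+\sigma_{-|x}$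 has trace one and does not depend on $x$. It has a local hidden state (LHS) model if $\sigma_{a|x}=\sum_{\lambda\in\Lambda} q_\lambda\, p(a|x,\lambda)\,\sigma_\lambda$ with $\Lambda$ finite, $q$ a probability distribution, $p(\cdot|x,\lambda)$ conditional probability distributions, and $\sigma_\lambda$ density matrices. A (dichotomic) steering inequality is a family $\mathbf F=(F_{\pm|x})_{x\in[g]}$ in $\mathcal M_d^{\mathrm{sa}}$; it is unbiased if $F_{-|x}=-F_{+|x}$ for all $x$. Let $V_{\mathcal Q}(\mathbf F)$, respectively $V_{\mathcal L}(\mathbf F)$, be the supremum of $\sum_{a,x}\operatorname{Tr}(\sigma_{a|x}F_{a|x})$ over all assemblages, respectively over all assemblages with an LHS model. For $\mathbf s\in[0,1]^g$ put $F^{(\mathbf s)}_{a|x}=s_xF_{a|x}+(1-s_x)\tfrac12(F_{+|x}+F_{-|x})$, and let $\Sigma(g,d)$ be the set of $\mathbf s\in[0,1]^g$ such that $V_{\mathcal L}(\mathbf F)\le1$ implies $V_{\mathcal Q}(\mathbf F^{(\mathbf s)})\le1$ for every steering inequality $\mathbf F$. Finally, $\gamma^0_{g,d}=\sup_{\mathbf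 F}V_{\mathcal Q}(\mathbf F)/V_{\mathcal L}(\mathbf F)$ over unbiased $\mathbf F$, with $0/0:=1$. *Pauli-type unitaries.* Let $F^{(0)}_1=[1]$ and, with the Pauli matrices $\sigma_X,\sigma_Y,\sigma_Z$, let $F^{(k+1)}_i=\sigma_X\otimes F^{(k)}_i$ for $i\in[2k+1]$, $F^{(k+1)}_{2k+2}=\sigma_Y\otimes I_{2^k}$ and $F^{(k+1)}_{2k+3}=\sigma_Z\otimes I_{2^k}$. **Proposition.** 1. For all $g,d\ge1$: $\Sigma(g,d)=\Delta_\square(g,d)\supseteq\{\mathbf s\in[0,1]^g:\sum_{i=1}^g s_i^2\le1\}$. 2. Let $g\ge2$, $k=\lceil(g-1)/2\rceil$ and $d\ge2^k$. Then $$\Sigma(g,d)=\Delta_\square(g,d)=\Big\{\mathbf s\in[0,1]^g:\sum_{i=1}^g s_i^2\le1\Big\}\qquad\text{and}\qquad\gamma^0_{g,d}=\sqrt g .$$ Moreover, the matrices $F_1^{(k)},\dots,F_g^{(k)}$ are self-adjoint unitaries with $F^{(k)}_xF^{(k)}_y+F^{(k)}_yF^{(k)}_x=2\delta_{x,y}I$.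 For every $\mathbf s\in[0,1]^g$, the unbiased steering inequality $\mathbf F_{\mathbf s}$ in dimension $d$ with $F_{+|x}=s_x\,(F^{(k)}_x\oplus 0_{d-2^k})$ and $F_{-|x}=-F_{+|x}$ satisfies $V_{\mathcal L}(\mathbf F_{\mathbf s})=\|\mathbf s\|_2$ and $V_{\mathcal Q}(\mathbf F_{\mathbf s})=\|\mathbf s\|_1$; in particular $\mathbf s=(1,\dots,1)$ attains $\gamma^0_{g,d}=\sqrt g$. -/

import Mathlib

namespace Steering

open scoped Kronecker ComplexOrder

/-! ### Free spectrahedra, the matrix cube and inclusion constants -/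

/-- A `g`-tuple of complex `n × n` matrices. -/
abbrev MatTuple (g n : ℕ) : Type := Fin g → Matrix (Fin n) (Fin n) ℂ

/-- Level `n` of the matrix cube: tuples of self-adjoint matrices of operator norm at most one. -/
noncomputable def matrixCube (g n : ℕ) : Set (MatTuple g n) :=
  {X | ∀ i, (X i).IsHermitian ∧ ‖Matrix.toEuclideanCLM (𝕜 := ℂ) (X i)‖ ≤ 1}

/-- Level `n` of the monic free spectrahedron of `B`: tuples `X` of self-adjoint matrices with
`∑ i, B i ⊗ X i ≤ I` in the positive semidefinite order. -/
noncomputable def freeSpectrahedron {g d : ℕ} (B : MatTuple g d) (n : ℕ) : Set (MatTuple g n) :=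
  {X | (∀ i, (X i).IsHermitian) ∧
    ((1 : Matrix (Fin d × Fin n) (Fin d × Fin n) ℂ) - ∑ i, B i ⊗ₖ X i).PosSemidef}

/-- The entrywise product `s.X = (s₁ X₁, …, s_g X_g)`. -/
noncomputable def scale {g n : ℕ} (s : Fin g → ℝ) (X : MatTuple g n) : MatTuple g n :=
  fun i => s i • X i

/-- The inclusion constant set, in dimension `d`, of a graded family `D` of sets of `g`-tuples:
those `s` in the unit cube such that `D(1) ⊆ 𝒟_B(1)` implies `s.D ⊆ 𝒟_B` at all levels, for every
`g`-tuple `B` of self-adjoint `d × d` matrices. -/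
noncomputable def inclusionConstants {g : ℕ} (D : ∀ n : ℕ, Set (MatTuple g n)) (d : ℕ) : Set (Fin g → ℝ) :=
  {s | (∀ i, s i ∈ Set.Icc (0 : ℝ) 1) ∧
    ∀ B : MatTuple g d, (∀ i, (B i).IsHermitian) →
      D 1 ⊆ freeSpectrahedron B 1 →
        ∀ n : ℕ, scale s '' D n ⊆ freeSpectrahedron B n}

/-- The inclusion constant set `Δ_□(g,d)` of the matrix cube. -/
noncomputable def cubeInclusionConstants (g d : ℕ) : Set (Fin g → ℝ) :=
  inclusionConstants (matrixCube g) d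

/-- The quarter-ball `{s ∈ [0,1]^g : ∑ s_i² ≤ 1}`. -/
noncomputable def quarterBall (g : ℕ) : Set (Fin g → ℝ) :=
  {s | (∀ i, s i ∈ Set.Icc (0 : ℝ) 1) ∧ ∑ i, s i ^ 2 ≤ 1}

/-! ### Assemblages and steering inequalities (two outcomes per measurement) -/

/-- A family of `d × d` matrices indexed by `g` settings and two outcomes; the outcome `+` is
`true` and the outcome `-` is `false`. -/
abbrev Family (g d : ℕ) : Type := Fin g → Bool → Matrix (Fin d) (Fin d) ℂ

/-- `ρ` is a density matrix. -/
noncomputable def IsDensity {d : ℕ} (ρ : Matrix (Fin d) (Fin d) ℂ) : Prop :=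
  ρ.PosSemidef ∧ ρ.trace = 1

/-- The set `𝒬(g,d)` of all assemblages: positive semidefinite families for which
`∑ a, σ_{a|x}` is a density matrix that does not depend on `x`. -/
noncomputable def assemblages (g d : ℕ) : Set (Family g d) :=
  {σ | (∀ x a, (σ x a).PosSemidef) ∧ (∀ x, ∑ a, (σ x a).trace = 1) ∧
    ∀ x y, ∑ a, σ x a = ∑ a, σ y a}

/-- The set `ℒ(g,d)` of assemblages with a local hidden state model
`σ_{a|x} = ∑ l, q_l p(a|x,l) ρ_l`, where `l` runs over a finite set. -/
noncomputable def lhsAssemblages (g d : ℕ) : Set (Family g d) :=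
  {σ | σ ∈ assemblages g d ∧
    ∃ (m : ℕ) (q : Fin m → ℝ) (p : Fin g → Fin m → Bool → ℝ)
      (ρ : Fin m → Matrix (Fin d) (Fin d) ℂ),
      (∀ l, 0 ≤ q l) ∧ ∑ l, q l = 1 ∧
      (∀ x l a, 0 ≤ p x l a) ∧ (∀ x l, ∑ a, p x l a = 1) ∧
      (∀ l, IsDensity (ρ l)) ∧
      ∀ x a, σ x a = ∑ l, (q l * p x l a) • ρ l}

/-- A dichotomic steering inequality: a family of self-adjoint matrices. -/
noncomputable def IsSteeringInequality {g d : ℕ} (F : Family g d) : Prop :=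
  ∀ x a, (F x a).IsHermitian

/-- The value `∑_{a,x} Tr(σ_{a|x} F_{a|x})` (which is real for self-adjoint families). -/
noncomputable def value {g d : ℕ} (F σ : Family g d) : ℝ :=
  (∑ x, ∑ a, (σ x a * F x a).trace).re

/-- The local hidden state value `V_ℒ(F)`. -/
noncomputable def lhsValue {g d : ℕ} (F : Family g d) : ℝ :=
  sSup (value F '' lhsAssemblages g d)

/-- The quantum value `V_𝒬(F)`. -/
noncomputable def quantumValue {g d : ℕ} (F : Family g d) : ℝ :=
  sSup (value F '' assemblages g d)

/-- The trivial realization `F⁽⁰⁾_{a|x} = (F_{+|x} + F_{-|x}) / 2`. -/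
noncomputable def trivialRealization {g d : ℕ} (F : Family g d) : Family g d :=
  fun x _ => (1 / 2 : ℝ) • ∑ b, F x b

/-- The mixture `F⁽ˢ⁾ = s.F + (1 - s).F⁽⁰⁾`. -/
noncomputable def mixture {g d : ℕ} (s : Fin g → ℝ) (F : Family g d) : Family g d :=
  fun x a => s x • F x a + (1 - s x) • trivialRealization F x a

/-- The set `Σ(g,d)` of steering constants. -/
noncomputable def steeringConstants (g d : ℕ) : Set (Fin g → ℝ) :=
  {s | (∀ i, s i ∈ Set.Icc (0 : ℝ) 1) ∧
    ∀ F : Family g d, IsSteeringInequality F →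
      lhsValue F ≤ 1 → quantumValue (mixture s F) ≤ 1}

/-- `F` is unbiased: `F_{-|x} = -F_{+|x}` for all `x`. -/
noncomputable def IsUnbiased {g d : ℕ} (F : Family g d) : Prop :=
  ∀ x, F x false = -F x true

open Classical in
/-- The quantum violation `V(F) = V_𝒬(F) / V_ℒ(F)`, with the convention `0 / 0 = 1`. -/
noncomputable def violation {g d : ℕ} (F : Family g d) : ℝ :=
  if lhsValue F = 0 ∧ quantumValue F = 0 then 1 else quantumValue F / lhsValue F

/-- The largest unbiased quantum violation `γ⁰_{g,d}`, a supremum of extended reals. -/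
noncomputable def largestUnbiasedViolation (g d : ℕ) : EReal :=
  ⨆ (F : Family g d) (_ : IsSteeringInequality F ∧ IsUnbiased F), (violation F : EReal)

/-- The unbiased family with `F_{+|x} = A x` and `F_{-|x} = -A x`. -/
noncomputable def unbiasedFamily {g d : ℕ} (A : MatTuple g d) : Family g d :=
  fun x a => if a then A x else -A x

/-! ### The anticommuting Pauli-type unitaries -/

/-- The Pauli matrix `σ_X`. -/
noncomputable def pauliX : Matrix (Fin 2) (Fin 2) ℂ := !![0, 1; 1, 0]

/-- The Pauli matrix `σ_Y`. -/
noncomputable def pauliY : Matrix (Fin 2) (Fin 2) ℂ := !![0, -Complex.I; Complex.I, 0]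

/-- The Pauli matrix `σ_Z`. -/
noncomputable def pauliZ : Matrix (Fin 2) (Fin 2) ℂ := !![1, 0; 0, -1]

/-- The tensor product of a `2 × 2` matrix and a `2^k × 2^k` matrix, as a matrix of size
`2^(k+1)`. -/
noncomputable def qubitTensor {k : ℕ} (P : Matrix (Fin 2) (Fin 2) ℂ)
    (M : Matrix (Fin (2 ^ k)) (Fin (2 ^ k)) ℂ) :
    Matrix (Fin (2 ^ (k + 1))) (Fin (2 ^ (k + 1))) ℂ :=
  Matrix.reindex (finProdFinEquiv.trans (finCongr (pow_succ' 2 k).symm))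
    (finProdFinEquiv.trans (finCongr (pow_succ' 2 k).symm)) (P ⊗ₖ M)

/-- The `2k+1` Pauli-type unitaries of size `2^k`. The index `i` starts at zero, and only the
indices `i < 2k+1` are meaningful. -/
noncomputable def pauliType : (k : ℕ) → ℕ → Matrix (Fin (2 ^ k)) (Fin (2 ^ k)) ℂ
  | 0, _ => 1
  | k + 1, i =>
    if i < 2 * k + 1 then qubitTensor pauliX (pauliType k i)
    else if i = 2 * k + 1 then qubitTensor pauliY 1
    else qubitTensor pauliZ 1

/-- `M ⊕ 0`: the matrix `M` in the upper left corner of a `d × d` matrix (for `D ≤ d`), with all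
other entries zero. -/
noncomputable def zeroPad {D : ℕ} (d : ℕ) (M : Matrix (Fin D) (Fin D) ℂ) : Matrix (Fin d) (Fin d) ℂ :=
  fun i j => if h : (i : ℕ) < D ∧ (j : ℕ) < D then M ⟨i, h.1⟩ ⟨j, h.2⟩ else 0

end Steering

namespace Steering

open scoped Kronecker ComplexOrder MatrixOrder Matrix
open Matrix

/-! Both sets of constants compare a commutative bound with a matrix bound. Write `F_{±|x} = K_x ±
A_x`. Deterministic strategies are extreme for local models, so `V_ℒ(F) ≤ 1` says `∑ ε_x A_x ≤ 1 -
K` for all signs, where `K = ∑ K_x`. For `K = 0` this is the level-one inclusion of the cube, whose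
extreme points are sign vectors (`lhsValue_le_iff`, `matrixCube_one_subset_iff`).

On the matrix side, a point `X` of the cube and a vector, viewed as a `d × n` matrix `V`, give the
assemblage `V (1 ± X_xᵀ) Vᴴ / (2 Tr V Vᴴ)`. Conversely, an assemblage with invertible reduced state
`ρ` gives the contractions `ρ^{-1/2} (σ_{+|x} - σ_{-|x}) ρ^{-1/2}`. A bias is removed by conjugation
with `(1 - K)^{-1/2}`; singular `1 - K` and `ρ` are reached by perturbation. Hence the two sets
agree.

The quarter-ball is contained in them because averaging `(∑ ε_i B_i)² ≤ 1` over signs leaves `∑ B_i²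
≤ 1`, after which Cauchy–Schwarz applies (`quarterBall_subset_cubeInclusionConstants`). For
anticommuting unitaries `(∑ s_x A_x)² = ‖s‖₂² 1`, so the local value is `‖s‖₂`, while the assemblage
`(P ± A_x) / (2 Tr P)` reaches `‖s‖₁`. Weights `s / ‖s‖₂` then exclude everything outside the ball.
The violation `√g` is attained at `s = (1,…,1)` and is maximal because `(g^{-1/2},…,g^{-1/2})` lies
in the ball. -/

theorem isHermitian_realSmul {m : Type*} {A : Matrix m m ℂ} (hA : A.IsHermitian) (c : ℝ) :
    (c • A).IsHermitian := IsSelfAdjoint.smul (.all c) hA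

theorem isHermitian_sum {m ι : Type*} (s : Finset ι) {A : ι → Matrix m m ℂ}
    (hA : ∀ i, (A i).IsHermitian) : (∑ i ∈ s, A i).IsHermitian :=
  Finset.sum_induction _ IsHermitian (fun _ _ => IsHermitian.add) isHermitian_zero fun i _ => hA i

/-! ### Real trace pairing and positivity -/

section Trace

variable {m : Type*} [Fintype m]

/-- The real part of `Tr (A * B)`, as a real bilinear form. -/
noncomputable def reTr : Matrix m m ℂ →ₗ[ℝ] Matrix m m ℂ →ₗ[ℝ] ℝ :=
  LinearMap.mk₂ ℝ (fun A B => (A * B).trace.re)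
    (by intros; simp [add_mul]) (by intros; simp) (by intros; simp [mul_add]) (by intros; simp)

theorem reTr_apply (A B : Matrix m m ℂ) : reTr A B = (A * B).trace.re := rfl

theorem reTr_comm (A B : Matrix m m ℂ) : reTr A B = reTr B A := by
  rw [reTr_apply, reTr_apply, trace_mul_comm]

theorem reTr_one [DecidableEq m] (A : Matrix m m ℂ) : reTr A 1 = A.trace.re := by
  rw [reTr_apply, mul_one]

theorem reTr_conj {n : Type*} [Fintype n] (V : Matrix m n ℂ) (Y : Matrix n n ℂ) (B : Matrix m m ℂ) :
    reTr (V * Y * Vᴴ) B = reTr Y (Vᴴ * B * V) := by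
  rw [reTr_apply, reTr_apply, Matrix.mul_assoc (V * Y), Matrix.mul_assoc V, trace_mul_comm]
  simp only [Matrix.mul_assoc]

theorem reTr_nonneg {A B : Matrix m m ℂ} (hA : A.PosSemidef) (hB : B.PosSemidef) :
    0 ≤ reTr A B := by
  classical
  obtain ⟨C, rfl⟩ := CStarAlgebra.nonneg_iff_eq_star_mul_self.mp hA.nonneg
  rw [reTr_apply, mul_assoc, trace_mul_comm]
  exact (Complex.nonneg_iff.mp (hB.mul_mul_conjTranspose_same C).trace_nonneg).1

theorem posSemidef_of_quadratic {B : Matrix m m ℂ} (hB : B.IsHermitian)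
    (h : ∀ v : m → ℂ, 0 ≤ (star v ⬝ᵥ B *ᵥ v).re) : B.PosSemidef := by
  refine .of_dotProduct_mulVec_nonneg hB fun v => Complex.nonneg_iff.mpr ⟨h v, ?_⟩
  exact (hB.im_star_dotProduct_mulVec_self v).symm

theorem quadratic_eq_reTr (B : Matrix m m ℂ) (v : m → ℂ) :
    (star v ⬝ᵥ B *ᵥ v).re = reTr (vecMulVec v (star v)) B := by
  rw [reTr_comm, reTr_apply, mul_vecMulVec, trace_vecMulVec, dotProduct_comm]

theorem posSemidef_of_reTr {B : Matrix m m ℂ} (hB : B.IsHermitian)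
    (h : ∀ A : Matrix m m ℂ, A.PosSemidef → A.trace = 1 → 0 ≤ reTr A B) : B.PosSemidef := by
  refine posSemidef_of_quadratic hB fun v => ?_
  rw [quadratic_eq_reTr]
  set A := vecMulVec v (star v)
  have hA : A.PosSemidef := posSemidef_vecMulVec_self_star v
  have ht := Complex.nonneg_iff.mp hA.trace_nonneg
  rcases ht.1.eq_or_lt with h0 | h0
  · have : A.trace = 0 := Complex.ext h0.symm ht.2.symm
    rw [hA.trace_eq_zero_iff.mp this]; simp
  · have hc : A.trace = (A.trace.re : ℂ) := Complex.ext rfl ht.2.symm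
    have := h ((A.trace.re)⁻¹ • A) (hA.smul (inv_nonneg.mpr h0.le)) (by
      rw [trace_smul, Complex.real_smul, Complex.ofReal_inv, ← hc]
      exact inv_mul_cancel₀ (by rw [hc]; exact_mod_cast h0.ne'))
    rw [map_smul, LinearMap.smul_apply, smul_eq_mul] at this
    exact nonneg_of_mul_nonneg_right this (inv_pos.mpr h0)

variable [DecidableEq m]

/-- `1 - X²` is the average of `(1-X)(1+X)(1-X)` and `(1+X)(1-X)(1+X)`, each a congruence of a
positive matrix. No spectral theorem is needed. -/
theorem posSemidef_one_sub_sq {X : Matrix m m ℂ} (h₁ : (1 - X).PosSemidef)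
    (h₂ : (1 + X).PosSemidef) : (1 - X * X).PosSemidef := by
  have e : 1 - X * X = (1 / 2 : ℝ) • ((1 - X) * (1 + X) * (1 - X)ᴴ + (1 + X) * (1 - X) * (1 + X)ᴴ) := by
    rw [h₁.1, h₂.1]
    have : (1 - X) * (1 + X) * (1 - X) + (1 + X) * (1 - X) * (1 + X) = (2 : ℝ) • (1 - X * X) := by
      rw [two_smul]; noncomm_ring
    rw [this, smul_smul]; norm_num
  rw [e]
  exact ((h₂.mul_mul_conjTranspose_same _).add (h₁.mul_mul_conjTranspose_same _)).smul (by norm_num)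

theorem norm_toEuclideanCLM_le_one_iff {X : Matrix m m ℂ} (hX : X.IsHermitian) :
    ‖Matrix.toEuclideanCLM (𝕜 := ℂ) X‖ ≤ 1 ↔ (1 - X).PosSemidef ∧ (1 + X).PosSemidef := by
  open scoped Matrix.Norms.L2Operator in
  rw [l2_opNorm_toEuclideanCLM]
  constructor
  · intro h
    have h1 : (‖X‖ • (1 : Matrix m m ℂ) - X).PosSemidef := by
      have := IsSelfAdjoint.le_algebraMap_norm_self (a := X) hX
      rwa [Algebra.algebraMap_eq_smul_one, Matrix.le_iff] at this
    have h2 : (‖X‖ • (1 : Matrix m m ℂ) + X).PosSemidef := by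
      have := IsSelfAdjoint.neg_algebraMap_norm_le_self (a := X) hX
      rwa [Algebra.algebraMap_eq_smul_one, Matrix.le_iff, sub_neg_eq_add, add_comm] at this
    have h3 : ((1 - ‖X‖) • (1 : Matrix m m ℂ)).PosSemidef :=
      PosSemidef.one.smul (sub_nonneg.mpr h)
    rw [sub_smul, one_smul] at h3
    constructor
    · convert h1.add h3 using 1; abel
    · convert h2.add h3 using 1; abel
  · rintro ⟨h1, h2⟩
    have h := posSemidef_one_sub_sq h1 h2
    have h0 : 0 ≤ X * X := by
      have := (posSemidef_conjTranspose_mul_self X).nonneg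
      rwa [hX] at this
    have := (CStarAlgebra.norm_le_one_iff_of_nonneg (X * X) h0).mpr h
    have hn : ‖X * X‖ = ‖X‖ * ‖X‖ := by
      have := l2_opNorm_conjTranspose_mul_self X
      rwa [hX] at this
    rw [hn] at this
    nlinarith [norm_nonneg X]

/-- Every self-adjoint matrix is bounded above by a multiple of the identity. -/
theorem exists_le_smul_one {A : Matrix m m ℂ} (hA : A.IsHermitian) :
    ∃ c : ℝ, 0 ≤ c ∧ (c • 1 - A).PosSemidef := by
  open scoped Matrix.Norms.L2Operator in
  refine ⟨‖A‖, norm_nonneg _, ?_⟩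
  have := IsSelfAdjoint.le_algebraMap_norm_self (a := A) hA
  rwa [Algebra.algebraMap_eq_smul_one, Matrix.le_iff] at this

end Trace

/-! ### Local and quantum values of steering inequalities -/

section Values

variable {g d : ℕ}

theorem value_eq_sum_reTr (F σ : Family g d) :
    value F σ = ∑ x, ∑ a, reTr (σ x a) (F x a) := by
  simp [value, reTr_apply]

theorem assemblage_trace {σ : Family g d} (hσ : σ ∈ assemblages g d) (x : Fin g) :
    (σ x true).trace.re + (σ x false).trace.re = 1 := by
  have := congrArg Complex.re (hσ.2.1 x)
  simpa using this

theorem assemblage_trace_nonneg {σ : Family g d} (hσ : σ ∈ assemblages g d) (x : Fin g)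
    (a : Bool) : 0 ≤ (σ x a).trace.re :=
  (Complex.nonneg_iff.mp (hσ.1 x a).trace_nonneg).1

theorem assemblage_trace_le_one {σ : Family g d} (hσ : σ ∈ assemblages g d) (x : Fin g)
    (a : Bool) : (σ x a).trace.re ≤ 1 := by
  have h := assemblage_trace hσ x
  have h1 := assemblage_trace_nonneg hσ x true
  have h2 := assemblage_trace_nonneg hσ x false
  cases a <;> linarith

theorem bddAbove_value {F : Family g d} (hF : IsSteeringInequality F) :
    BddAbove (value F '' assemblages g d) := by
  choose c hc0 hc using fun x a => exists_le_smul_one (hF x a)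
  refine ⟨∑ x, ∑ a, c x a, ?_⟩
  rintro _ ⟨σ, hσ, rfl⟩
  rw [value_eq_sum_reTr]
  refine Finset.sum_le_sum fun x _ => Finset.sum_le_sum fun a _ => ?_
  have h := reTr_nonneg (hσ.1 x a) (hc x a)
  rw [map_sub, map_smul, reTr_one, smul_eq_mul] at h
  nlinarith [assemblage_trace_le_one hσ x a, hc0 x a]

/-- The assemblage given by a deterministic strategy `f` and a single hidden state `ρ`. -/
noncomputable def deterministicAssemblage (f : Fin g → Bool) (ρ : Matrix (Fin d) (Fin d) ℂ) :
    Family g d :=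
  fun x a => if a = f x then ρ else 0

theorem deterministicAssemblage_mem (f : Fin g → Bool) {ρ : Matrix (Fin d) (Fin d) ℂ}
    (hρ : IsDensity ρ) : deterministicAssemblage f ρ ∈ lhsAssemblages g d := by
  refine ⟨⟨fun x a => ?_, fun x => ?_, fun x y => ?_⟩, 1, fun _ => 1,
    fun x _ a => if a = f x then 1 else 0, fun _ => ρ, ?_, ?_, ?_, ?_, fun _ => hρ, ?_⟩
  · rw [deterministicAssemblage]
    split_ifs
    exacts [hρ.1, .zero]
  · simp only [deterministicAssemblage]
    rw [← trace_sum]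
    simp [hρ.2]
  · simp [deterministicAssemblage]
  · simp
  · simp
  · intros; dsimp only; split_ifs <;> norm_num
  · simp
  · intro x a
    simp [deterministicAssemblage]

theorem value_deterministicAssemblage (F : Family g d) (f : Fin g → Bool)
    (ρ : Matrix (Fin d) (Fin d) ℂ) :
    value F (deterministicAssemblage f ρ) = reTr ρ (∑ x, F x (f x)) := by
  rw [value_eq_sum_reTr, map_sum]
  refine Finset.sum_congr rfl fun x _ => ?_
  rw [Finset.sum_eq_single (f x)] <;> simp +contextual [deterministicAssemblage]

theorem exists_isDensity (hd : 1 ≤ d) : ∃ ρ : Matrix (Fin d) (Fin d) ℂ, IsDensity ρ := by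
  refine ⟨(d : ℝ)⁻¹ • 1, PosSemidef.one.smul (by positivity), ?_⟩
  have : (d : ℂ) ≠ 0 := by exact_mod_cast (by omega : d ≠ 0)
  simp [trace_smul, this]

theorem lhsAssemblages_nonempty (hd : 1 ≤ d) : (lhsAssemblages g d).Nonempty :=
  let ⟨_, hρ⟩ := exists_isDensity hd
  ⟨_, deterministicAssemblage_mem (fun _ => true) hρ⟩

theorem lhsAssemblages_subset : lhsAssemblages g d ⊆ assemblages g d := fun _ h => h.1

theorem quantumValue_le_iff (hd : 1 ≤ d) {F : Family g d} (hF : IsSteeringInequality F) {c : ℝ} :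
    quantumValue F ≤ c ↔ ∀ σ ∈ assemblages g d, value F σ ≤ c := by
  rw [quantumValue, csSup_le_iff (bddAbove_value hF)
    (((lhsAssemblages_nonempty hd).mono lhsAssemblages_subset).image _), Set.forall_mem_image]

/-- The local hidden state value is the largest eigenvalue over deterministic strategies. -/
theorem lhsValue_le_iff (hd : 1 ≤ d) {F : Family g d} (hF : IsSteeringInequality F) {c : ℝ} :
    lhsValue F ≤ c ↔ ∀ f : Fin g → Bool, (c • 1 - ∑ x, F x (f x)).PosSemidef := by
  rw [lhsValue, csSup_le_iff ((bddAbove_value hF).mono (Set.image_mono lhsAssemblages_subset))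
    ((lhsAssemblages_nonempty hd).image _), Set.forall_mem_image]
  constructor
  · intro h f
    refine posSemidef_of_reTr ((isHermitian_realSmul isHermitian_one c).sub
      (isHermitian_sum _ fun x => hF x (f x))) fun ρ hρ ht => ?_
    have := h (deterministicAssemblage_mem f ⟨hρ, ht⟩)
    rw [value_deterministicAssemblage] at this
    rw [map_sub, map_smul, reTr_one, ht]
    simpa using this
  · rintro h σ ⟨-, m, q, p, ρ, hq, hq1, hp, hp1, hρ, hσ⟩
    have key : ∀ l, ∑ x, ∑ a, p x l a * reTr (ρ l) (F x a) ≤ c := by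
      intro l
      -- For a fixed hidden state, the best response is deterministic: pick the outcome with the
      -- larger payoff at each setting.
      choose f hf using fun x => Finite.exists_max fun a => reTr (ρ l) (F x a)
      have h1 := reTr_nonneg (hρ l).1 (h f)
      rw [map_sub, map_smul, reTr_one, (hρ l).2, map_sum] at h1
      simp only [Complex.one_re, smul_eq_mul, mul_one, sub_nonneg] at h1
      refine le_trans (Finset.sum_le_sum fun x _ => ?_) h1
      calc ∑ a, p x l a * reTr (ρ l) (F x a)
          ≤ ∑ a, p x l a * reTr (ρ l) (F x (f x)) :=
            Finset.sum_le_sum fun a _ => mul_le_mul_of_nonneg_left (hf x a) (hp x l a)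
        _ = reTr (ρ l) (F x (f x)) := by rw [← Finset.sum_mul, hp1, one_mul]
    have e : value F σ = ∑ l, q l * ∑ x, ∑ a, p x l a * reTr (ρ l) (F x a) := by
      simp only [value_eq_sum_reTr, hσ, map_sum, LinearMap.sum_apply, map_smul,
        LinearMap.smul_apply, smul_eq_mul, Finset.mul_sum, mul_assoc]
      rw [Finset.sum_comm_cycle]
    rw [e]
    calc _ ≤ ∑ l, q l * c := Finset.sum_le_sum fun l _ => mul_le_mul_of_nonneg_left (key l) (hq l)
      _ = c := by rw [← Finset.sum_mul, hq1, one_mul]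

/-- Half the difference of the two outcomes of a steering inequality. -/
noncomputable def halfDiff (F : Family g d) : MatTuple g d :=
  fun x => (1 / 2 : ℝ) • (F x true - F x false)

/-- The deterministic bias of a steering inequality. -/
noncomputable def bias (F : Family g d) : Matrix (Fin d) (Fin d) ℂ :=
  ∑ x, (1 / 2 : ℝ) • (F x true + F x false)

/-- The sign of an outcome. -/
def outcomeSign (a : Bool) : ℝ := if a then 1 else -1

theorem isHermitian_halfDiff {F : Family g d} (hF : IsSteeringInequality F) (x : Fin g) :
    (halfDiff F x).IsHermitian :=
  isHermitian_realSmul ((hF x _).sub (hF x _)) _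

theorem isSteeringInequality_mixture {F : Family g d} (hF : IsSteeringInequality F)
    (s : Fin g → ℝ) : IsSteeringInequality (mixture s F) := fun x a =>
  (isHermitian_realSmul (hF x a) _).add <| isHermitian_realSmul
    (isHermitian_realSmul (isHermitian_sum _ fun b => hF x b) _) _

theorem sum_strategy_eq (F : Family g d) (f : Fin g → Bool) :
    ∑ x, F x (f x) = ∑ x, outcomeSign (f x) • halfDiff F x + bias F := by
  rw [bias, ← Finset.sum_add_distrib]
  refine Finset.sum_congr rfl fun x _ => ?_
  cases f x <;> simp only [outcomeSign, halfDiff] <;> simp <;> module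

/-- Mixing with the mean of the two outcomes damps only their difference; the bias contribution
keeps weight one whatever `s` is. -/
theorem value_mixture (s : Fin g → ℝ) (F σ : Family g d) {ρ : Matrix (Fin d) (Fin d) ℂ}
    (hρ : ∀ x, σ x true + σ x false = ρ) :
    value (mixture s F) σ =
      ∑ x, s x * reTr (σ x true - σ x false) (halfDiff F x) + reTr ρ (bias F) := by
  rw [value_eq_sum_reTr, bias, map_sum, ← Finset.sum_add_distrib]
  refine Finset.sum_congr rfl fun x _ => ?_
  rw [← hρ x]
  simp only [Fintype.sum_bool, mixture, trivialRealization, halfDiff, map_add, map_sub, map_smul,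
    LinearMap.add_apply, LinearMap.sub_apply, smul_eq_mul]
  ring

end Values

/-! ### Free spectrahedra and the quarter-ball -/

section Spectrahedra

variable {g d n : ℕ}

/-- A vector of `ℂ^d ⊗ ℂ^n` is a `d × n` matrix `V`, on which `B ⊗ X` acts as `V ↦ B V Xᵀ`. This is
the source of every transpose below, and it gives the quadratic form the shape of a steering value.
-/
theorem quadratic_kronecker (B : Matrix (Fin d) (Fin d) ℂ) (X : Matrix (Fin n) (Fin n) ℂ)
    (V : Matrix (Fin d) (Fin n) ℂ) :
    (star (vec Vᵀ) ⬝ᵥ (B ⊗ₖ X) *ᵥ vec Vᵀ).re = reTr (V * Xᵀ * Vᴴ) B := by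
  rw [kronecker_mulVec_vec, star_vec_dotProduct_vec, ← trace_transpose, reTr_comm, reTr_apply]
  congr 1
  simp only [transpose_mul, transpose_transpose, ← Matrix.mul_assoc]
  rfl

theorem mem_freeSpectrahedron_iff {B : MatTuple g d} (hB : ∀ i, (B i).IsHermitian)
    (X : MatTuple g n) :
    X ∈ freeSpectrahedron B n ↔ (∀ i, (X i).IsHermitian) ∧
      ∀ V : Matrix (Fin d) (Fin n) ℂ,
        ∑ i, reTr (V * (X i)ᵀ * Vᴴ) (B i) ≤ reTr (V * Vᴴ) 1 := by
  have key : ∀ V : Matrix (Fin d) (Fin n) ℂ,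
      (star (vec Vᵀ) ⬝ᵥ (1 - ∑ i, B i ⊗ₖ X i) *ᵥ vec Vᵀ).re =
        reTr (V * Vᴴ) 1 - ∑ i, reTr (V * (X i)ᵀ * Vᴴ) (B i) := by
    intro V
    have h1 := quadratic_kronecker (1 : Matrix (Fin d) (Fin d) ℂ) (1 : Matrix (Fin n) (Fin n) ℂ) V
    rw [one_kronecker_one, transpose_one, Matrix.mul_one] at h1
    rw [sub_mulVec, dotProduct_sub, Complex.sub_re, h1, sum_mulVec, dotProduct_sum, Complex.re_sum]
    simp only [quadratic_kronecker]
  rw [freeSpectrahedron, Set.mem_ofPred_eq]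
  refine and_congr_right fun hX => ⟨fun h V => ?_, fun h => ?_⟩
  · have := (Complex.nonneg_iff.mp (h.dotProduct_mulVec_nonneg (vec Vᵀ))).1
    rw [key] at this
    linarith
  · refine posSemidef_of_quadratic (isHermitian_one.sub (isHermitian_sum _ fun i => ?_)) fun v => ?_
    · rw [IsHermitian, conjTranspose_kronecker, hB i, hX i]
    · obtain ⟨W, rfl⟩ := vec_bijective.2 v
      have := key Wᵀ
      rw [transpose_transpose] at this
      rw [this, sub_nonneg]
      exact h _

/-- All signed sums `∑ i, ± B i` are at most the identity. -/
def SignBounded (B : MatTuple g d) : Prop :=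
  ∀ f : Fin g → Bool, (1 - ∑ i, outcomeSign (f i) • B i).PosSemidef

theorem outcomeSign_not (a : Bool) : outcomeSign (!a) = -outcomeSign a := by
  cases a <;> simp [outcomeSign]

theorem outcomeSign_mul_self (a : Bool) : outcomeSign a * outcomeSign a = 1 := by
  cases a <;> simp [outcomeSign]

theorem sum_outcomeSign_not (f : Fin g → Bool) (B : MatTuple g d) :
    ∑ i, outcomeSign (!f i) • B i = -∑ i, outcomeSign (f i) • B i := by
  simp [outcomeSign_not]

/-- The signs may be chosen after `ρ`, matching those of the numbers `Tr (ρ B_i)`. -/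
theorem SignBounded.sum_abs_le {B : MatTuple g d} (hB : SignBounded B)
    {ρ : Matrix (Fin d) (Fin d) ℂ} (hρ : ρ.PosSemidef) :
    ∑ i, |reTr ρ (B i)| ≤ reTr ρ 1 := by
  have h := reTr_nonneg hρ (hB fun i => decide (0 ≤ reTr ρ (B i)))
  rw [map_sub, map_sum, sub_nonneg] at h
  refine le_trans (Finset.sum_le_sum fun i _ => ?_) h
  rw [map_smul, smul_eq_mul]
  by_cases h0 : 0 ≤ reTr ρ (B i)
  · simp [outcomeSign, h0, abs_of_nonneg]
  · simp [outcomeSign, h0, abs_of_neg (not_le.mp h0)]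

theorem mem_matrixCube_iff {X : MatTuple g n} :
    X ∈ matrixCube g n ↔ ∀ i, (X i).IsHermitian ∧ (1 - X i).PosSemidef ∧ (1 + X i).PosSemidef :=
  forall_congr' fun _ => and_congr_right norm_toEuclideanCLM_le_one_iff

theorem matrixCube_one_subset_iff {B : MatTuple g d} (hB : ∀ i, (B i).IsHermitian) :
    matrixCube g 1 ⊆ freeSpectrahedron B 1 ↔ SignBounded B := by
  constructor
  · intro h f
    -- The vertices of the scalar cube already produce all signed sums.
    have hX : (fun i => outcomeSign (f i) • (1 : Matrix (Fin 1) (Fin 1) ℂ)) ∈ matrixCube g 1 := by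
      refine mem_matrixCube_iff.mpr fun i => ⟨isHermitian_realSmul isHermitian_one _, ?_, ?_⟩
      · rw [show (1 : Matrix (Fin 1) (Fin 1) ℂ) - outcomeSign (f i) • 1 =
          (1 - outcomeSign (f i)) • 1 by rw [sub_smul, one_smul]]
        exact PosSemidef.one.smul (by cases f i <;> norm_num [outcomeSign])
      · rw [show (1 : Matrix (Fin 1) (Fin 1) ℂ) + outcomeSign (f i) • 1 =
          (1 + outcomeSign (f i)) • 1 by rw [add_smul, one_smul]]
        exact PosSemidef.one.smul (by cases f i <;> norm_num [outcomeSign])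
    have hV := ((mem_freeSpectrahedron_iff hB _).mp (h hX)).2
    refine posSemidef_of_quadratic (isHermitian_one.sub
      (isHermitian_sum _ fun i => isHermitian_realSmul (hB i) _)) fun v => ?_
    have e : replicateCol (Fin 1) v * (replicateCol (Fin 1) v)ᴴ = vecMulVec v (star v) := by
      ext a b
      simp [Matrix.mul_apply, vecMulVec_apply]
    have := hV (replicateCol (Fin 1) v)
    simp only [transpose_smul, transpose_one, Matrix.mul_smul, smul_mul, Matrix.mul_one, map_smul,
      LinearMap.smul_apply, e] at this
    rw [quadratic_eq_reTr, map_sub, map_sum]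
    simpa [map_smul] using this
  · intro h X hX
    rw [mem_matrixCube_iff] at hX
    refine (mem_freeSpectrahedron_iff hB _).mpr ⟨fun i => (hX i).1, fun V => ?_⟩
    refine le_trans (Finset.sum_le_sum fun i _ => ?_)
      (h.sum_abs_le (posSemidef_self_mul_conjTranspose V))
    obtain ⟨hH, h1, h2⟩ := hX i
    set t := (X i 0 0).re with ht
    have hXt : (X i)ᵀ = t • 1 := by
      ext a b
      obtain rfl := Subsingleton.elim a 0
      obtain rfl := Subsingleton.elim b 0
      have := hH.apply 0 0
      simp [ht, Complex.conj_eq_iff_re.mp this]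
    have h1' := (Complex.nonneg_iff.mp (h1.diag_nonneg (i := 0))).1
    have h2' := (Complex.nonneg_iff.mp (h2.diag_nonneg (i := 0))).1
    simp only [Matrix.sub_apply, Matrix.add_apply, one_apply_eq, Complex.sub_re, Complex.add_re,
      Complex.one_re, ← ht] at h1' h2'
    rw [hXt, Matrix.mul_smul, smul_mul, Matrix.mul_one, map_smul, LinearMap.smul_apply, smul_eq_mul]
    refine (le_abs_self _).trans ?_
    rw [abs_mul]
    exact mul_le_of_le_one_left (abs_nonneg _) (abs_le.mpr ⟨by linarith, by linarith⟩)

/-- Membership in the inclusion constants of the cube, tested on vectorised matrices. -/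
theorem mem_cubeInclusionConstants_iff {s : Fin g → ℝ} :
    s ∈ cubeInclusionConstants g d ↔ (∀ i, s i ∈ Set.Icc (0 : ℝ) 1) ∧
      ∀ B : MatTuple g d, (∀ i, (B i).IsHermitian) → SignBounded B →
        ∀ n : ℕ, ∀ X ∈ matrixCube g n, ∀ V : Matrix (Fin d) (Fin n) ℂ,
          ∑ i, s i * reTr (V * (X i)ᵀ * Vᴴ) (B i) ≤ reTr (V * Vᴴ) 1 := by
  rw [cubeInclusionConstants, inclusionConstants, Set.mem_ofPred_eq]
  refine and_congr_right fun _ => forall_congr' fun B => forall_congr' fun hB => ?_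
  rw [matrixCube_one_subset_iff hB]
  refine forall_congr' fun _ => forall_congr' fun n => ?_
  rw [Set.image_subset_iff]
  refine forall_congr' fun X => forall_congr' fun hX => ?_
  rw [Set.mem_preimage, mem_freeSpectrahedron_iff hB]
  have e : ∀ (V : Matrix (Fin d) (Fin n) ℂ) i, reTr (V * (scale s X i)ᵀ * Vᴴ) (B i) =
      s i * reTr (V * (X i)ᵀ * Vᴴ) (B i) := fun V i => by
    rw [scale, transpose_smul, Matrix.mul_smul, smul_mul, map_smul, LinearMap.smul_apply, smul_eq_mul]
  simp only [e]
  exact and_iff_right fun i => isHermitian_realSmul (hX i).1 _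

theorem sum_outcomeSign_mul (x y : Fin g) :
    ∑ f : Fin g → Bool, outcomeSign (f x) * outcomeSign (f y) =
      if x = y then (2 : ℝ) ^ g else 0 := by
  split_ifs with h
  · subst h
    simp [outcomeSign_mul_self]
  -- Flipping the sign at `x` alone reverses the summand, so the sum equals its own negative.
  · have hinv : Function.Involutive fun f : Fin g → Bool => Function.update f x (!f x) := by
      intro f
      simp
    have := Equiv.sum_comp hinv.toPerm fun f => outcomeSign (f x) * outcomeSign (f y)
    simp only [Function.Involutive.coe_toPerm, Function.update_self,
      Function.update_of_ne (Ne.symm h), outcomeSign_not, neg_mul, Finset.sum_neg_distrib] at this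
    linarith

/-- Each signed sum lies between `-1` and `1`, so its square is at most `1`. Averaging over
independent signs removes the cross terms `B_i B_j`. -/
theorem SignBounded.sum_sq_le {B : MatTuple g d} (hB : SignBounded B) :
    (1 - ∑ i, B i * B i).PosSemidef := by
  set M : (Fin g → Bool) → Matrix (Fin d) (Fin d) ℂ := fun f => ∑ i, outcomeSign (f i) • B i
  have h : ∀ f, (1 - M f * M f).PosSemidef := fun f => by
    refine posSemidef_one_sub_sq (hB f) ?_
    have := hB fun i => !f i
    rwa [sum_outcomeSign_not, sub_neg_eq_add] at this
  have e : ∑ f, (1 - M f * M f) = (2 : ℝ) ^ g • (1 - ∑ i, B i * B i) := by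
    have h2 : ∑ f, M f * M f = (2 : ℝ) ^ g • ∑ i, B i * B i := by
      simp only [M, Finset.sum_mul_sum, smul_mul_smul_comm]
      rw [Finset.sum_comm, Finset.smul_sum]
      refine Finset.sum_congr rfl fun x _ => ?_
      rw [Finset.sum_comm]
      simp [← Finset.sum_smul, sum_outcomeSign_mul]
    rw [Finset.sum_sub_distrib, h2, smul_sub]
    congr 1
    simp [← Nat.cast_smul_eq_nsmul ℝ]
  have h3 := (posSemidef_sum Finset.univ fun f _ => h f).smul (a := ((2 : ℝ) ^ g)⁻¹) (by positivity)
  rwa [e, smul_smul, inv_mul_cancel₀ (by positivity), one_smul] at h3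

/-- Cauchy–Schwarz in the form `2ab ≤ a² + b²`: summing `key` over `i` bounds twice the left side by
`(1 + ∑ s_i²) τ ≤ 2τ`. -/
theorem quarterBall_subset_cubeInclusionConstants :
    quarterBall g ⊆ cubeInclusionConstants g d := by
  rintro s ⟨hs, hs2⟩
  refine mem_cubeInclusionConstants_iff.mpr ⟨hs, fun B hB hSB n X hX V => ?_⟩
  rw [mem_matrixCube_iff] at hX
  set τ := reTr (V * Vᴴ) 1 with hτ
  have hτ0 : 0 ≤ τ := reTr_nonneg (posSemidef_self_mul_conjTranspose V) .one
  have hBB : ∑ i, reTr (V * Vᴴ) (B i * B i) ≤ τ := by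
    have := reTr_nonneg (posSemidef_self_mul_conjTranspose V) hSB.sum_sq_le
    rwa [map_sub, map_sum, sub_nonneg] at this
  have hXX : ∀ i, reTr (V * ((X i)ᵀ * (X i)ᵀ) * Vᴴ) 1 ≤ τ := by
    intro i
    have h := ((posSemidef_one_sub_sq (hX i).2.1 (hX i).2.2).transpose).mul_mul_conjTranspose_same V
    have := reTr_nonneg h .one
    rwa [transpose_sub, transpose_one, transpose_mul, Matrix.mul_sub, Matrix.sub_mul, Matrix.mul_one, map_sub,
      LinearMap.sub_apply, sub_nonneg] at this
  have key : ∀ i, 2 * (s i * reTr (V * (X i)ᵀ * Vᴴ) (B i)) ≤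
      reTr (V * Vᴴ) (B i * B i) + s i ^ 2 * τ := by
    intro i
    set Y := (X i)ᵀ
    have hY : Yᴴ = Y := (hX i).1.transpose
    -- This is the Hilbert–Schmidt square of `B_i V - s_i V Y`. Its two cross terms are distinct
    -- products with equal real trace, hence both `e2` and `e3`.
    have h := reTr_nonneg (posSemidef_self_mul_conjTranspose (B i * V - s i • (V * Y))) .one
    have e : reTr ((B i * V - s i • (V * Y)) * (B i * V - s i • (V * Y))ᴴ) 1 =
        reTr (V * Vᴴ) (B i * B i) - 2 * (s i * reTr (V * Y * Vᴴ) (B i)) +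
          s i ^ 2 * reTr (V * (Y * Y) * Vᴴ) 1 := by
      have e1 : reTr (V * Vᴴ) (B i * B i) = reTr (B i * V * (Vᴴ * B i)) 1 := by
        rw [reTr_one, reTr_apply, Matrix.mul_assoc V, trace_mul_comm V, trace_mul_comm (B i * V)]
        simp only [Matrix.mul_assoc]
      have e2 : reTr (V * Y * Vᴴ) (B i) = reTr (B i * V * (Y * Vᴴ)) 1 := by
        rw [reTr_one, reTr_comm, reTr_apply]
        simp only [Matrix.mul_assoc]
      have e3 : reTr (V * Y * Vᴴ) (B i) = reTr (V * Y * (Vᴴ * B i)) 1 := by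
        rw [reTr_one, reTr_apply]
        simp only [Matrix.mul_assoc]
      have e4 : reTr (V * (Y * Y) * Vᴴ) 1 = reTr (V * Y * (Y * Vᴴ)) 1 := by
        simp only [Matrix.mul_assoc]
      rw [two_mul, e1, e4]
      nth_rewrite 1 [e2]
      rw [e3]
      simp only [conjTranspose_sub, conjTranspose_smul, conjTranspose_mul, hY, (hB i).eq,
        star_trivial, Matrix.mul_sub, Matrix.sub_mul, smul_mul, Matrix.mul_smul, map_sub, map_smul,
        LinearMap.sub_apply, LinearMap.smul_apply, smul_eq_mul]
      ring
    rw [e] at h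
    nlinarith [hXX i, sq_nonneg (s i)]
  have := Finset.sum_le_sum fun i (_ : i ∈ Finset.univ) => key i
  rw [← Finset.mul_sum, Finset.sum_add_distrib, ← Finset.sum_mul] at this
  nlinarith

end Spectrahedra

/-! ### Steering constants equal inclusion constants -/

section Equivalence

variable {g d : ℕ}

theorem isSteeringInequality_unbiasedFamily {A : MatTuple g d} (hA : ∀ x, (A x).IsHermitian) :
    IsSteeringInequality (unbiasedFamily A) := by
  intro x a
  cases a
  · exact (hA x).neg
  · exact hA x

theorem sum_unbiasedFamily (A : MatTuple g d) (f : Fin g → Bool) :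
    ∑ x, unbiasedFamily A x (f x) = ∑ x, outcomeSign (f x) • A x :=
  Finset.sum_congr rfl fun x _ => by cases f x <;> simp [unbiasedFamily, outcomeSign]

theorem value_unbiasedFamily (A : MatTuple g d) (σ : Family g d) :
    value (unbiasedFamily A) σ = ∑ x, reTr (σ x true - σ x false) (A x) := by
  rw [value_eq_sum_reTr]
  refine Finset.sum_congr rfl fun x _ => ?_
  simp [unbiasedFamily, sub_eq_add_neg]

theorem mixture_unbiasedFamily (s : Fin g → ℝ) (A : MatTuple g d) :
    mixture s (unbiasedFamily A) = unbiasedFamily (scale s A) := by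
  ext1 x
  ext1 a
  cases a <;> simp [mixture, trivialRealization, unbiasedFamily, scale]

theorem lhsValue_unbiasedFamily_le_iff (hd : 1 ≤ d) {A : MatTuple g d}
    (hA : ∀ x, (A x).IsHermitian) {c : ℝ} :
    lhsValue (unbiasedFamily A) ≤ c ↔
      ∀ f : Fin g → Bool, (c • 1 - ∑ x, outcomeSign (f x) • A x).PosSemidef := by
  simp only [lhsValue_le_iff hd (isSteeringInequality_unbiasedFamily hA), sum_unbiasedFamily]

/-- Steering constants are inclusion constants. -/
theorem steeringConstants_subset (hd : 1 ≤ d) :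
    steeringConstants g d ⊆ cubeInclusionConstants g d := by
  rintro s ⟨hs, h⟩
  refine mem_cubeInclusionConstants_iff.mpr ⟨hs, fun B hB hSB n X hX V => ?_⟩
  rw [mem_matrixCube_iff] at hX
  have hF := isSteeringInequality_unbiasedFamily hB
  have hQ := h (unbiasedFamily B) hF ((lhsValue_unbiasedFamily_le_iff hd hB).mpr fun f => by
    rw [one_smul]; exact hSB f)
  rw [quantumValue_le_iff hd (isSteeringInequality_mixture hF s), mixture_unbiasedFamily] at hQ
  have hVV := posSemidef_self_mul_conjTranspose V
  have ht := Complex.nonneg_iff.mp hVV.trace_nonneg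
  -- The assemblage below is normalised by `t = Tr V Vᴴ`, so `V = 0` is separated off.
  rcases ht.1.eq_or_lt with h0 | h0
  · have : V = 0 := trace_mul_conjTranspose_self_eq_zero_iff.mp (Complex.ext h0.symm ht.2.symm)
    simp [this]
  set t := (V * Vᴴ).trace.re with htdef
  have hT : (V * Vᴴ).trace = (t : ℂ) := Complex.ext rfl ht.2.symm
  set σ : Family g d := fun x a =>
    (2 * t)⁻¹ • (V * (1 + outcomeSign a • (X x)ᵀ) * Vᴴ) with hσdef
  have hsum : ∀ x, σ x true + σ x false = t⁻¹ • (V * Vᴴ) := fun x => by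
    simp only [hσdef, outcomeSign, if_true, Bool.false_eq_true, if_false, one_smul, neg_smul]
    rw [← smul_add, ← Matrix.add_mul, ← Matrix.mul_add,
      show (1 + (X x)ᵀ + (1 + -(X x)ᵀ)) = (2 : ℝ) • (1 : Matrix (Fin n) (Fin n) ℂ) by
        rw [two_smul]; abel, Matrix.mul_smul, Matrix.smul_mul, smul_smul, Matrix.mul_one]
    congr 1
    field_simp
  have hdiff : ∀ x, σ x true - σ x false = t⁻¹ • (V * (X x)ᵀ * Vᴴ) := fun x => by
    simp only [hσdef, outcomeSign, if_true, Bool.false_eq_true, if_false, one_smul, neg_smul]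
    rw [← smul_sub, ← Matrix.sub_mul, ← Matrix.mul_sub,
      show (1 + (X x)ᵀ - (1 + -(X x)ᵀ)) = (2 : ℝ) • (X x)ᵀ by
        rw [two_smul]; abel, Matrix.mul_smul, Matrix.smul_mul, smul_smul]
    congr 1
    field_simp
  have hσ : σ ∈ assemblages g d := by
    refine ⟨fun x a => ?_, fun x => ?_, fun x y => ?_⟩
    · refine PosSemidef.smul (PosSemidef.mul_mul_conjTranspose_same ?_ V) (by positivity)
      cases a
      · simpa [outcomeSign, ← sub_eq_add_neg] using (hX x).2.1.transpose
      · simpa [outcomeSign] using (hX x).2.2.transpose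
    · rw [← trace_sum, Fintype.sum_bool, hsum, trace_smul, hT, Complex.real_smul,
        ← Complex.ofReal_mul, inv_mul_cancel₀ h0.ne', Complex.ofReal_one]
    · simp only [Fintype.sum_bool, hsum]
  have := hQ σ hσ
  rw [value_unbiasedFamily] at this
  simp only [hdiff, scale, map_smul, LinearMap.smul_apply, smul_eq_mul] at this
  rw [reTr_one, ← htdef]
  have e : ∑ x, s x * reTr (V * (X x)ᵀ * Vᴴ) (B x) =
      t * ∑ x, s x * (t⁻¹ * reTr (V * (X x)ᵀ * Vᴴ) (B x)) := by
    rw [Finset.mul_sum]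
    refine Finset.sum_congr rfl fun x _ => ?_
    field_simp
  rw [e]
  exact mul_le_of_le_one_right h0.le this

theorem _root_.Matrix.PosDef.exists_sq_eq {m : Type*} [Fintype m] [DecidableEq m]
    {A : Matrix m m ℂ} (hA : A.PosDef) :
    ∃ C D : Matrix m m ℂ, C.IsHermitian ∧ D.IsHermitian ∧ C * C = A ∧ C * D = 1 ∧ D * C = 1 := by
  set C := CFC.sqrt A
  have hC : C.IsHermitian := (CFC.sqrt_nonneg A).posSemidef.1
  have hCC : C * C = A := CFC.sqrt_mul_sqrt_self A hA.posSemidef.nonneg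
  have hu : IsUnit C.det := by
    have := (isUnit_iff_isUnit_det _).mp hA.isUnit
    rw [← hCC, det_mul] at this
    exact isUnit_of_mul_isUnit_left this
  exact ⟨C, C⁻¹, hC, hC.inv, hCC, mul_nonsing_inv _ hu, nonsing_inv_mul _ hu⟩

theorem halfDiff_sum_le {F : Family g d} (hd : 1 ≤ d) (hF : IsSteeringInequality F)
    (hL : lhsValue F ≤ 1) (f : Fin g → Bool) :
    (1 - bias F - ∑ x, outcomeSign (f x) • halfDiff F x).PosSemidef := by
  have := (lhsValue_le_iff hd hF).mp hL f
  rwa [sum_strategy_eq, one_smul, ← sub_sub, sub_right_comm] at this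

/-- Average the bounds for a strategy and its opposite: the signed parts cancel. -/
theorem one_sub_bias_posSemidef {F : Family g d} (hd : 1 ≤ d) (hF : IsSteeringInequality F)
    (hL : lhsValue F ≤ 1) : (1 - bias F).PosSemidef := by
  have h1 := halfDiff_sum_le hd hF hL fun _ => true
  have h2 := halfDiff_sum_le hd hF hL fun _ => !true
  rw [sum_outcomeSign_not (fun _ => true), sub_neg_eq_add] at h2
  convert (h1.add h2).smul (a := (1 / 2 : ℝ)) (by norm_num) using 1
  module

/-- The steering bound for assemblages with an invertible reduced state. -/
theorem value_mixture_le_of_posDef (hd : 1 ≤ d) {s : Fin g → ℝ}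
    (hs : s ∈ cubeInclusionConstants g d) {F : Family g d} (hF : IsSteeringInequality F)
    (hL : lhsValue F ≤ 1) {σ : Family g d} (hσ : σ ∈ assemblages g d)
    {ρ : Matrix (Fin d) (Fin d) ℂ} (hρ : ∀ x, σ x true + σ x false = ρ) (hρ' : ρ.PosDef)
    (hρt : ρ.trace = 1) :
    value (mixture s F) σ ≤ 1 := by
  -- `1 - bias F` is only semidefinite; adding `δ` makes its square root `C` invertible, at the cost
  -- of slack `δ` in the bound.
  refine le_of_forall_pos_le_add fun δ hδ => ?_
  have hK : (1 - bias F + δ • 1).PosDef :=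
    PosDef.posSemidef_add (one_sub_bias_posSemidef hd hF hL) (PosDef.one.smul hδ)
  obtain ⟨C, D, hC, hD, hCC, hCD, hDC⟩ := hK.exists_sq_eq
  obtain ⟨P, Q, hP, hQ, hPP, hPQ, hQP⟩ := hρ'.exists_sq_eq
  have hA := isHermitian_halfDiff hF
  have hB : ∀ x, (D * halfDiff F x * D).IsHermitian := fun x => by
    have := isHermitian_mul_mul_conjTranspose D (hA x)
    rwa [hD.eq] at this
  have hSB : SignBounded fun x => D * halfDiff F x * D := fun f => by
    have h := ((halfDiff_sum_le hd hF hL f).add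
      (PosSemidef.one.smul hδ.le)).mul_mul_conjTranspose_same D
    rw [hD.eq] at h
    convert h using 1
    have e : D * (1 - bias F + δ • 1) * D = 1 := by
      rw [← hCC, ← mul_assoc, hDC, one_mul, hCD]
    rw [sub_add_eq_add_sub, mul_sub, sub_mul, e, Finset.mul_sum, Finset.sum_mul]
    simp only [Matrix.mul_smul, Matrix.smul_mul]
  -- With `Q = ρ^{-1/2}`, the identity `Q ρ Q = 1` turns `σ_{±|x} ≥ 0` into `-1 ≤ T_x ≤ 1`.
  set T : MatTuple g d := fun x => Q * (σ x true - σ x false) * Q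
  have hQρ : Q * ρ * Q = 1 := by rw [← hPP, ← mul_assoc, hQP, one_mul, hPQ]
  have hT1 : ∀ x, 1 - T x = (2 : ℝ) • (Q * σ x false * Qᴴ) := fun x => by
    rw [hQ.eq, ← hQρ, ← hρ x]
    simp only [T, mul_add, mul_sub, add_mul, sub_mul]
    module
  have hT2 : ∀ x, 1 + T x = (2 : ℝ) • (Q * σ x true * Qᴴ) := fun x => by
    rw [hQ.eq, ← hQρ, ← hρ x]
    simp only [T, mul_add, mul_sub, add_mul, sub_mul]
    module
  have hX : (fun x => (T x)ᵀ) ∈ matrixCube g d := by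
    refine mem_matrixCube_iff.mpr fun x => ⟨?_, ?_, ?_⟩
    · have := isHermitian_mul_mul_conjTranspose Q ((hσ.1 x true).1.sub (hσ.1 x false).1)
      rw [hQ.eq] at this
      exact this.transpose
    · have : (1 - T x).PosSemidef := by
        rw [hT1]
        exact ((hσ.1 x false).mul_mul_conjTranspose_same Q).smul (by norm_num)
      simpa using this.transpose
    · have : (1 + T x).PosSemidef := by
        rw [hT2]
        exact ((hσ.1 x true).mul_mul_conjTranspose_same Q).smul (by norm_num)
      simpa using this.transpose
  -- The test matrix `V = (1 - K + δ)^{1/2} ρ^{1/2}` undoes both normalisations: the left side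
  -- becomes the steering value without its bias, and `Tr V Vᴴ = 1 - Tr (ρ K) + δ`. Passing `Tᵀ`
  -- cancels the transpose in the criterion.
  have h := (mem_cubeInclusionConstants_iff.mp hs).2 _ hB hSB d _ hX (C * P)
  have e1 : ∀ x, reTr (C * P * (T x)ᵀᵀ * (C * P)ᴴ) (D * halfDiff F x * D) =
      reTr (σ x true - σ x false) (halfDiff F x) := fun x => by
    have e : C * P * (T x)ᵀᵀ * (C * P)ᴴ = C * (σ x true - σ x false) * Cᴴ := by
      rw [transpose_transpose, conjTranspose_mul, hP.eq]
      calc C * P * (Q * (σ x true - σ x false) * Q) * (P * Cᴴ)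
          = C * (P * Q) * (σ x true - σ x false) * (Q * P) * Cᴴ := by simp only [mul_assoc]
        _ = _ := by rw [hPQ, hQP, mul_one, mul_one]
    rw [e, reTr_conj, hC.eq]
    congr 1
    calc C * (D * halfDiff F x * D) * C = C * D * halfDiff F x * (D * C) := by
          simp only [mul_assoc]
      _ = _ := by rw [hCD, hDC, mul_one, one_mul]
  have e2 : reTr (C * P * (C * P)ᴴ) 1 = 1 - reTr ρ (bias F) + δ := by
    have e : C * P * (C * P)ᴴ = C * ρ * Cᴴ := by
      rw [conjTranspose_mul, hP.eq, ← hPP]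
      simp only [mul_assoc]
    rw [e, reTr_conj, mul_one, hC.eq, hCC, map_add, map_sub, map_smul, reTr_one, hρt]
    simp
  simp only [e1, e2] at h
  rw [value_mixture s F σ hρ]
  linarith

theorem value_convex_combination (F σ τ : Family g d) (a b : ℝ) :
    value F (fun x c => a • σ x c + b • τ x c) = a * value F σ + b * value F τ := by
  simp only [value_eq_sum_reTr, map_add, map_smul, LinearMap.add_apply, LinearMap.smul_apply,
    smul_eq_mul, Finset.sum_add_distrib, Finset.mul_sum]

/-- Inclusion constants are steering constants. -/
theorem cubeInclusionConstants_subset (hg : 1 ≤ g) (hd : 1 ≤ d) :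
    cubeInclusionConstants g d ⊆ steeringConstants g d := by
  intro s hs
  refine ⟨(mem_cubeInclusionConstants_iff.mp hs).1, fun F hF hL => ?_⟩
  rw [quantumValue_le_iff hd (isSteeringInequality_mixture hF s)]
  intro σ hσ
  have hd' : (d : ℂ) ≠ 0 := by exact_mod_cast (by omega : d ≠ 0)
  -- Mixing in weight `δ` of this maximally mixed assemblage makes the reduced state positive
  -- definite; the value is affine in `δ`, so `δ → 0` recovers the bound for `σ`.
  set τ : Family g d := fun _ _ => (2 * d : ℝ)⁻¹ • 1
  have hτ : ∀ x, τ x true + τ x false = (d : ℝ)⁻¹ • 1 := fun x => by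
    rw [← add_smul]
    congr 1
    field_simp
    norm_num
  have h : ∀ δ ∈ Set.Ioc (0 : ℝ) 1,
      (1 - δ) * value (mixture s F) σ + δ * value (mixture s F) τ ≤ 1 := by
    rintro δ ⟨h0, h1⟩
    rw [← value_convex_combination]
    set ω : Family g d := fun x c => (1 - δ) • σ x c + δ • τ x c
    set ρ := σ ⟨0, hg⟩ true + σ ⟨0, hg⟩ false
    have hσρ : ∀ x, σ x true + σ x false = ρ := fun x => by
      simpa only [Fintype.sum_bool] using hσ.2.2 x ⟨0, hg⟩
    have hω : ∀ x, ω x true + ω x false = (1 - δ) • ρ + δ • (d : ℝ)⁻¹ • 1 := fun x => by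
      rw [← hτ x, ← hσρ x]
      module
    have hωt : ((1 - δ) • ρ + δ • (d : ℝ)⁻¹ • (1 : Matrix (Fin d) (Fin d) ℂ)).trace = 1 := by
      have : ρ.trace = 1 := by
        simpa only [← trace_sum, Fintype.sum_bool] using hσ.2.1 ⟨0, hg⟩
      simp [trace_smul, this, hd']
    refine value_mixture_le_of_posDef hd hs hF hL (σ := ω) ⟨fun x a => ?_, fun x => ?_,
      fun x y => ?_⟩ hω ?_ hωt
    · exact ((hσ.1 x a).smul (sub_nonneg.mpr h1)).add
        ((PosSemidef.one.smul (by positivity)).smul h0.le)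
    · rw [← trace_sum, Fintype.sum_bool, hω, hωt]
    · simp only [Fintype.sum_bool, hω]
    · exact PosDef.posSemidef_add
        (((hσ.1 _ _).add (hσ.1 _ _)).smul (sub_nonneg.mpr h1))
        ((PosDef.one.smul (by positivity)).smul h0)
  have ht : Filter.Tendsto
      (fun δ : ℝ => (1 - δ) * value (mixture s F) σ + δ * value (mixture s F) τ)
      (nhdsWithin 0 (Set.Ioi 0)) (nhds (value (mixture s F) σ)) := by
    have : Continuous fun δ : ℝ =>
      (1 - δ) * value (mixture s F) σ + δ * value (mixture s F) τ := by fun_prop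
    simpa using this.continuousWithinAt (s := Set.Ioi 0) (x := 0) |>.tendsto
  refine le_of_tendsto ht ?_
  filter_upwards [Ioc_mem_nhdsGT zero_lt_one] with δ hδ using h δ hδ

theorem steeringConstants_eq (hg : 1 ≤ g) (hd : 1 ≤ d) :
    steeringConstants g d = cubeInclusionConstants g d :=
  (steeringConstants_subset hd).antisymm (cubeInclusionConstants_subset hg hd)

end Equivalence

/-! ### Anticommutation of the Pauli-type unitaries -/

section Pauli

variable {k : ℕ}

theorem qubitTensor_mul (P Q : Matrix (Fin 2) (Fin 2) ℂ)
    (M N : Matrix (Fin (2 ^ k)) (Fin (2 ^ k)) ℂ) :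
    qubitTensor P M * qubitTensor Q N = qubitTensor (P * Q) (M * N) := by
  rw [qubitTensor, qubitTensor, qubitTensor, mul_kronecker_mul, reindex_apply, reindex_apply,
    reindex_apply, submatrix_mul_equiv]

theorem qubitTensor_isHermitian {P : Matrix (Fin 2) (Fin 2) ℂ}
    {M : Matrix (Fin (2 ^ k)) (Fin (2 ^ k)) ℂ} (hP : P.IsHermitian) (hM : M.IsHermitian) :
    (qubitTensor P M).IsHermitian := by
  rw [qubitTensor, reindex_apply]
  refine IsHermitian.submatrix ?_ _
  rw [IsHermitian, conjTranspose_kronecker, hP, hM]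

theorem qubitTensor_one_one :
    qubitTensor 1 (1 : Matrix (Fin (2 ^ k)) (Fin (2 ^ k)) ℂ) = 1 := by
  rw [qubitTensor, one_kronecker_one, reindex_apply, submatrix_one_equiv]

theorem qubitTensor_neg_left (P : Matrix (Fin 2) (Fin 2) ℂ)
    (M : Matrix (Fin (2 ^ k)) (Fin (2 ^ k)) ℂ) : qubitTensor (-P) M = -qubitTensor P M := by
  ext i j
  simp [qubitTensor]

theorem qubitTensor_neg_right (P : Matrix (Fin 2) (Fin 2) ℂ)
    (M : Matrix (Fin (2 ^ k)) (Fin (2 ^ k)) ℂ) : qubitTensor P (-M) = -qubitTensor P M := by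
  ext i j
  simp [qubitTensor]

theorem pauliX_isHermitian : pauliX.IsHermitian := by
  ext i j; fin_cases i <;> fin_cases j <;> simp [pauliX]

theorem pauliY_isHermitian : pauliY.IsHermitian := by
  ext i j; fin_cases i <;> fin_cases j <;> simp [pauliY]

theorem pauliZ_isHermitian : pauliZ.IsHermitian := by
  ext i j; fin_cases i <;> fin_cases j <;> simp [pauliZ]

theorem pauliX_mul_self : pauliX * pauliX = 1 := by
  ext i j; fin_cases i <;> fin_cases j <;> simp [pauliX]

theorem pauliY_mul_self : pauliY * pauliY = 1 := by
  ext i j; fin_cases i <;> fin_cases j <;> simp [pauliY]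

theorem pauliZ_mul_self : pauliZ * pauliZ = 1 := by
  ext i j; fin_cases i <;> fin_cases j <;> simp [pauliZ]

theorem pauliX_mul_pauliY : pauliX * pauliY = -(pauliY * pauliX) := by
  ext i j; fin_cases i <;> fin_cases j <;> simp [pauliX, pauliY]

theorem pauliX_mul_pauliZ : pauliX * pauliZ = -(pauliZ * pauliX) := by
  ext i j; fin_cases i <;> fin_cases j <;> simp [pauliX, pauliZ]

theorem pauliY_mul_pauliZ : pauliY * pauliZ = -(pauliZ * pauliY) := by
  ext i j; fin_cases i <;> fin_cases j <;> simp [pauliY, pauliZ]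

theorem pauliType_isHermitian (k i : ℕ) : (pauliType k i).IsHermitian := by
  induction k with
  | zero => exact isHermitian_one
  | succ k ih =>
    rw [pauliType]
    split_ifs
    exacts [qubitTensor_isHermitian pauliX_isHermitian ih,
      qubitTensor_isHermitian pauliY_isHermitian isHermitian_one,
      qubitTensor_isHermitian pauliZ_isHermitian isHermitian_one]

theorem pauliType_mul_self (k i : ℕ) : pauliType k i * pauliType k i = 1 := by
  induction k with
  | zero => exact one_mul _
  | succ k ih =>
    rw [pauliType]
    split_ifs
    · rw [qubitTensor_mul, ih, pauliX_mul_self, qubitTensor_one_one]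
    · rw [qubitTensor_mul, one_mul, pauliY_mul_self, qubitTensor_one_one]
    · rw [qubitTensor_mul, one_mul, pauliZ_mul_self, qubitTensor_one_one]

/-- If both indices come from level `k`, the sign comes from the second tensor factor by induction,
the first being `σ_X² = 1`. Otherwise two different Pauli matrices supply it, and the second factors
commute because one of them is `1`. -/
theorem pauliType_anticomm_of_lt (k : ℕ) {i j : ℕ} (hij : i < j) (hj : j < 2 * k + 1) :
    pauliType k i * pauliType k j = -(pauliType k j * pauliType k i) := by
  induction k generalizing i j with
  | zero => omega
  | succ k ih =>
    rw [pauliType, pauliType]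
    by_cases h1 : j < 2 * k + 1
    · rw [if_pos h1, if_pos (hij.trans h1), qubitTensor_mul, qubitTensor_mul, ih hij h1,
        qubitTensor_neg_right]
    · by_cases h2 : j = 2 * k + 1
      · rw [if_pos (by omega : i < 2 * k + 1), if_neg h1, if_pos h2, qubitTensor_mul,
          qubitTensor_mul, pauliX_mul_pauliY, mul_one, one_mul, qubitTensor_neg_left]
      · rw [if_neg h1, if_neg h2]
        split_ifs with h3 h4
        · rw [qubitTensor_mul, qubitTensor_mul, pauliX_mul_pauliZ, mul_one, one_mul,
            qubitTensor_neg_left]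
        · rw [qubitTensor_mul, qubitTensor_mul, pauliY_mul_pauliZ, qubitTensor_neg_left]
        · omega

theorem pauliType_anticomm {i j : ℕ} (hij : i ≠ j) (hi : i < 2 * k + 1) (hj : j < 2 * k + 1) :
    pauliType k i * pauliType k j = -(pauliType k j * pauliType k i) := by
  rcases hij.lt_or_gt with h | h
  · exact pauliType_anticomm_of_lt k h hj
  · rw [pauliType_anticomm_of_lt k h hi, neg_neg]

end Pauli

/-! ### Padding by zeros as compression along an isometry -/

section ZeroPad

variable {D d : ℕ}

/-- The coordinate isometry `ℂ^D → ℂ^d`. -/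
noncomputable def padIsometry (h : D ≤ d) : Matrix (Fin d) (Fin D) ℂ :=
  (1 : Matrix (Fin d) (Fin d) ℂ).submatrix id (Fin.castLE h)

theorem padIsometry_conjTranspose_mul (h : D ≤ d) : (padIsometry h)ᴴ * padIsometry h = 1 := by
  rw [padIsometry, conjTranspose_submatrix, conjTranspose_one,
    ← submatrix_mul _ _ _ _ _ Function.bijective_id, one_mul,
    submatrix_one _ (Fin.castLE_injective h)]

theorem zeroPad_eq (h : D ≤ d) (M : Matrix (Fin D) (Fin D) ℂ) :
    zeroPad d M = padIsometry h * M * (padIsometry h)ᴴ := by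
  ext i j
  have e : ∀ (i : Fin d) (a : Fin D), padIsometry h i a = if (i : ℕ) = a then 1 else 0 := by
    intro i a
    simp [padIsometry, one_apply, Fin.ext_iff]
  simp only [zeroPad, Matrix.mul_apply, conjTranspose_apply, e]
  split_ifs with hij
  · obtain ⟨hi, hj⟩ := hij
    rw [Finset.sum_eq_single ⟨j, hj⟩, Finset.sum_eq_single ⟨i, hi⟩]
    · simp
    · intro b _ hb
      rw [if_neg (fun he => hb (Fin.ext he.symm)), zero_mul]
    · simp
    · intro b _ hb
      rw [if_neg (fun he => hb (Fin.ext he.symm)), star_zero, mul_zero]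
    · simp
  · symm
    refine Finset.sum_eq_zero fun b _ => ?_
    by_cases hj : (j : ℕ) = b
    · rw [Finset.sum_eq_zero, zero_mul]
      intro a _
      rw [if_neg, zero_mul]
      intro hi
      exact hij ⟨hi ▸ a.2, hj ▸ b.2⟩
    · rw [if_neg hj, star_zero, mul_zero]

theorem zeroPad_mul (h : D ≤ d) (M N : Matrix (Fin D) (Fin D) ℂ) :
    zeroPad d M * zeroPad d N = zeroPad d (M * N) := by
  rw [zeroPad_eq h, zeroPad_eq h, zeroPad_eq h]
  calc padIsometry h * M * (padIsometry h)ᴴ * (padIsometry h * N * (padIsometry h)ᴴ)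
      = padIsometry h * M * ((padIsometry h)ᴴ * padIsometry h) * N * (padIsometry h)ᴴ := by
        simp only [Matrix.mul_assoc]
    _ = _ := by rw [padIsometry_conjTranspose_mul, Matrix.mul_one, Matrix.mul_assoc _ M N]

theorem zeroPad_neg (M : Matrix (Fin D) (Fin D) ℂ) : zeroPad d (-M) = -zeroPad d M := by
  ext i j
  simp only [zeroPad, Matrix.neg_apply]
  split_ifs <;> simp

theorem zeroPad_isHermitian (h : D ≤ d) {M : Matrix (Fin D) (Fin D) ℂ} (hM : M.IsHermitian) :
    (zeroPad d M).IsHermitian := by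
  rw [zeroPad_eq h]
  exact isHermitian_mul_mul_conjTranspose _ hM

end ZeroPad

/-! ### The upper bound `√g` on unbiased violations -/

section UnbiasedValues

variable {g d : ℕ}

/-- Opposite strategies give opposite operators, so adding their bounds leaves `2 V_ℒ · 1 ≥ 0`. -/
theorem lhsValue_unbiasedFamily_nonneg (hd : 1 ≤ d) {A : MatTuple g d}
    (hA : ∀ x, (A x).IsHermitian) : 0 ≤ lhsValue (unbiasedFamily A) := by
  have h := (lhsValue_unbiasedFamily_le_iff hd hA).mp le_rfl
  have h1 := h fun _ => true
  have h2 := h fun _ => !true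
  rw [sum_outcomeSign_not (fun _ => true), sub_neg_eq_add] at h2
  have := (Complex.nonneg_iff.mp ((h1.add h2).diag_nonneg (i := ⟨0, hd⟩))).1
  simp at this
  linarith

/-- The unbiased quantum value exceeds the local one by at most a factor `√g`. -/
theorem quantumValue_unbiasedFamily_le (hg : 1 ≤ g) (hd : 1 ≤ d) {A : MatTuple g d}
    (hA : ∀ x, (A x).IsHermitian) (hL : 0 < lhsValue (unbiasedFamily A)) :
    quantumValue (unbiasedFamily A) ≤ Real.sqrt g * lhsValue (unbiasedFamily A) := by
  set L := lhsValue (unbiasedFamily A)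
  have hg0 : (0 : ℝ) < g := by exact_mod_cast hg
  -- The diagonal point of the unit sphere is a steering constant; applied to `A` rescaled to local
  -- value at most one, it gives the factor `√g`.
  have hc : (fun _ => (Real.sqrt g)⁻¹) ∈ quarterBall g := by
    refine ⟨fun _ => ⟨by positivity, inv_le_one_of_one_le₀ ?_⟩, ?_⟩
    · exact Real.one_le_sqrt.mpr (by exact_mod_cast hg)
    · simp [hg0.ne']
  have hSig := (cubeInclusionConstants_subset hg hd
    (quarterBall_subset_cubeInclusionConstants hc)).2
  have hA' : ∀ x, (scale (fun _ => L⁻¹) A x).IsHermitian := fun x => isHermitian_realSmul (hA x) _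
  have hL' : lhsValue (unbiasedFamily (scale (fun _ => L⁻¹) A)) ≤ 1 := by
    refine (lhsValue_unbiasedFamily_le_iff hd hA').mpr fun f => ?_
    have := ((lhsValue_unbiasedFamily_le_iff hd hA).mp le_rfl f).smul (inv_nonneg.mpr hL.le)
    rw [smul_sub, smul_smul, inv_mul_cancel₀ hL.ne', Finset.smul_sum] at this
    simpa only [scale, smul_comm L⁻¹] using this
  have hF := isSteeringInequality_unbiasedFamily hA'
  have hQ := hSig _ hF hL'
  rw [quantumValue_le_iff hd (isSteeringInequality_mixture hF _), mixture_unbiasedFamily] at hQ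
  refine (quantumValue_le_iff hd (isSteeringInequality_unbiasedFamily hA)).mpr fun σ hσ => ?_
  have h := hQ σ hσ
  rw [value_unbiasedFamily] at h ⊢
  simp only [scale, map_smul, smul_eq_mul, ← Finset.mul_sum] at h
  rw [← mul_assoc, ← mul_inv, inv_mul_le_iff₀ (by positivity), mul_one] at h
  exact h

theorem violation_le (hg : 1 ≤ g) (hd : 1 ≤ d) {F : Family g d} (hF : IsSteeringInequality F)
    (hU : IsUnbiased F) : violation F ≤ Real.sqrt g := by
  have hFA : F = unbiasedFamily fun x => F x true := by
    ext1 x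
    ext1 a
    cases a
    · exact hU x
    · rfl
  have hA : ∀ x, (F x true).IsHermitian := fun x => hF x true
  rw [violation]
  split_ifs with h
  · exact Real.one_le_sqrt.mpr (by exact_mod_cast hg)
  · rcases (lhsValue_unbiasedFamily_nonneg hd hA).eq_or_lt with h0 | h0
    · rw [← hFA] at h0
      -- A vanishing local value is settled by the convention `x / 0 = 0`.
      rw [← h0, div_zero]
      exact Real.sqrt_nonneg _
    · have := quantumValue_unbiasedFamily_le hg hd hA h0
      rw [← hFA] at this h0
      exact (div_le_iff₀ h0).mpr this

end UnbiasedValues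

/-! ### Exact values for anticommuting systems -/

section Anticommuting

variable {g d : ℕ}

/-- Anticommuting self-adjoint unitaries on the range of a nonzero projection `P`. -/
structure IsAnticommutingSystem (P : Matrix (Fin d) (Fin d) ℂ) (A : MatTuple g d) : Prop where
  isHermitian : ∀ x, (A x).IsHermitian
  isHermitian_proj : P.IsHermitian
  proj_ne_zero : P ≠ 0
  mul_self : ∀ x, A x * A x = P
  anticomm : ∀ x y, x ≠ y → A x * A y = -(A y * A x)
  mul_proj : ∀ x, A x * P = A x

/-- `P` is a projection acting as identity on `U`, so `(P - U)² = 2 (P - U)`. -/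
theorem proj_sub_posSemidef {P U : Matrix (Fin d) (Fin d) ℂ} (hP : P.IsHermitian)
    (hU : U.IsHermitian) (h : U * U = P) (hUP : U * P = U) : (P - U).PosSemidef := by
  have hPU : P * U = U := by
    have := congrArg conjTranspose hUP
    rwa [conjTranspose_mul, hP, hU] at this
  have hPP : P * P = P := by
    nth_rewrite 2 [← h]
    rw [← mul_assoc, hPU, h]
  have e : P - U = (1 / 2 : ℝ) • ((P - U) * (P - U)ᴴ) := by
    rw [(hP.sub hU).eq, mul_sub, sub_mul, sub_mul, hPP, hPU, hUP, h]
    module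
  rw [e]
  exact (posSemidef_self_mul_conjTranspose _).smul (by norm_num)

theorem one_sub_posSemidef {P U : Matrix (Fin d) (Fin d) ℂ} (hP : P.IsHermitian)
    (hU : U.IsHermitian) (h : U * U = P) (hUP : U * P = U) : (1 - U).PosSemidef := by
  have hPP : P * P = P := by
    nth_rewrite 1 [← h]
    rw [mul_assoc, hUP, h]
  have h1 : (1 - P).PosSemidef := by
    have e : 1 - P = (1 - P) * (1 - P)ᴴ := by
      rw [(isHermitian_one.sub hP).eq, mul_sub, sub_mul, sub_mul, hPP]
      simp
    rw [e]
    exact posSemidef_self_mul_conjTranspose _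
  convert h1.add (proj_sub_posSemidef hP hU h hUP) using 1
  abel

namespace IsAnticommutingSystem

variable {P : Matrix (Fin d) (Fin d) ℂ} {A : MatTuple g d} (h : IsAnticommutingSystem P A)

theorem scale_isHermitian (h : IsAnticommutingSystem P A) (s : Fin g → ℝ) (x : Fin g) : (scale s A x).IsHermitian :=
  isHermitian_realSmul (h.isHermitian x) _

theorem sum_mul_sum (h : IsAnticommutingSystem P A) (s : Fin g → ℝ) :
    (∑ x, s x • A x) * ∑ x, s x • A x = (∑ x, s x ^ 2) • P := by
  have h1 : (∑ x, s x • A x) * ∑ x, s x • A x =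
      ∑ x, ∑ y, (s x * s y) • (A x * A y) := by
    simp only [Finset.sum_mul_sum, smul_mul_smul_comm]
  have h2 := h1.trans Finset.sum_comm
  -- Adding the double sum to its transpose pairs `A_x A_y` with `A_y A_x`; off the diagonal these
  -- cancel.
  have e : (2 : ℝ) • ((∑ x, s x • A x) * ∑ x, s x • A x) = (2 : ℝ) • (∑ x, s x ^ 2) • P := by
    rw [two_smul]
    nth_rewrite 1 [h1]
    rw [h2, ← Finset.sum_add_distrib, Finset.sum_smul, Finset.smul_sum]
    refine Finset.sum_congr rfl fun x _ => ?_
    rw [← Finset.sum_add_distrib, Finset.sum_eq_single x]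
    · rw [h.mul_self]
      module
    · intro y _ hy
      rw [h.anticomm y x hy]
      module
    · simp
  exact smul_right_injective _ (two_ne_zero' ℝ) e

theorem proj_trace_pos (h : IsAnticommutingSystem P A) (hg : 0 < g) : 0 < P.trace.re := by
  have hP : P.PosSemidef := by
    rw [← h.mul_self ⟨0, hg⟩]
    nth_rewrite 2 [← (h.isHermitian ⟨0, hg⟩).eq]
    exact posSemidef_self_mul_conjTranspose _
  have ht := Complex.nonneg_iff.mp hP.trace_nonneg
  refine ht.1.lt_of_ne fun h0 => h.proj_ne_zero (hP.trace_eq_zero_iff.mp ?_)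
  exact Complex.ext h0.symm ht.2.symm

/-- A second index `y` gives `A_x = A_x A_y² = -A_y A_x A_y`, whose trace is `-Tr A_x` by cyclicity.
With one setting this fails, for instance for `A_x = P`. -/
theorem trace_eq_zero (h : IsAnticommutingSystem P A) (hg : 2 ≤ g) (x : Fin g) : (A x).trace = 0 := by
  have : Nontrivial (Fin g) := Fin.nontrivial_iff_two_le.mpr hg
  obtain ⟨y, hy⟩ := exists_ne x
  have e : (A x).trace = -(A x).trace := by
    calc (A x).trace = (A x * (A y * A y)).trace := by rw [h.mul_self, h.mul_proj]
      _ = -(A y * A x * A y).trace := by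
        rw [← mul_assoc, h.anticomm x y hy.symm, neg_mul, trace_neg]
      _ = -(A x).trace := by rw [mul_assoc, trace_mul_comm, mul_assoc, h.mul_self, h.mul_proj]
  exact self_eq_neg.mp e

/-- The unitary part of a signed combination with nonzero coefficients. -/
theorem normalized_sum (h : IsAnticommutingSystem P A) (s : Fin g → ℝ) {t : ℝ} (ht : 0 < t) (hts : t ^ 2 = ∑ x, s x ^ 2) :
    (t⁻¹ • ∑ x, s x • A x).IsHermitian ∧
      (t⁻¹ • ∑ x, s x • A x) * (t⁻¹ • ∑ x, s x • A x) = P ∧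
      (t⁻¹ • ∑ x, s x • A x) * P = t⁻¹ • ∑ x, s x • A x := by
  refine ⟨isHermitian_realSmul (isHermitian_sum _ fun x => h.scale_isHermitian s x) _, ?_, ?_⟩
  · rw [smul_mul_smul_comm, h.sum_mul_sum, ← hts, smul_smul]
    convert one_smul ℝ P using 2
    field_simp
  · rw [smul_mul_assoc, Finset.sum_mul]
    simp only [smul_mul_assoc, h.mul_proj]

/-- Every signed sum is `t U` with `U² = P`, hence at most `t`. Equality holds because `U` has trace
zero, so `P + U` is a nonzero positive matrix on which `U` acts as the identity. -/
theorem lhsValue_eq (h : IsAnticommutingSystem P A) (hg : 2 ≤ g) (hd : 1 ≤ d) (s : Fin g → ℝ) :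
    lhsValue (unbiasedFamily (scale s A)) = Real.sqrt (∑ x, s x ^ 2) := by
  have hH := h.scale_isHermitian s
  set t := Real.sqrt (∑ x, s x ^ 2) with ht
  have htt : t ^ 2 = ∑ x, s x ^ 2 := Real.sq_sqrt (Finset.sum_nonneg fun x _ => sq_nonneg _)
  rcases (Real.sqrt_nonneg (∑ x, s x ^ 2)).eq_or_lt with h0 | h0
  · rw [← ht] at h0
    have hs : ∀ x, s x = 0 := fun x => by
      have := (Finset.sum_eq_zero_iff_of_nonneg fun x _ => sq_nonneg (s x)).mp
        (htt.symm.trans (by rw [← h0]; norm_num)) x (Finset.mem_univ x)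
      exact pow_eq_zero_iff two_ne_zero |>.mp this
    refine le_antisymm ((lhsValue_unbiasedFamily_le_iff hd hH).mpr fun f => ?_)
      (h0 ▸ lhsValue_unbiasedFamily_nonneg hd hH)
    simpa [scale, hs, ← h0] using PosSemidef.zero
  rw [← ht] at h0
  refine le_antisymm ((lhsValue_unbiasedFamily_le_iff hd hH).mpr fun f => ?_) ?_
  · have e : ∑ x, outcomeSign (f x) • scale s A x = ∑ x, (outcomeSign (f x) * s x) • A x := by
      simp only [scale, smul_smul]
    have hts : t ^ 2 = ∑ x, (outcomeSign (f x) * s x) ^ 2 := by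
      simp only [mul_pow, pow_two (outcomeSign _), outcomeSign_mul_self, one_mul, htt]
    obtain ⟨h1, h2, h3⟩ := h.normalized_sum _ h0 hts
    have := (one_sub_posSemidef h.isHermitian_proj h1 h2 h3).smul h0.le
    rwa [smul_sub, smul_smul, mul_inv_cancel₀ h0.ne', one_smul, ← e] at this
  · have hle := (lhsValue_unbiasedFamily_le_iff hd hH).mp le_rfl fun _ => true
    have e : ∑ x, outcomeSign true • scale s A x = ∑ x, s x • A x := by
      simp [outcomeSign, scale]
    rw [e] at hle
    obtain ⟨h1, h2, h3⟩ := h.normalized_sum s h0 htt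
    set U := t⁻¹ • ∑ x, s x • A x with hU
    have hM : ∑ x, s x • A x = t • U := by
      rw [hU, smul_smul, mul_inv_cancel₀ h0.ne', one_smul]
    have hP := proj_sub_posSemidef h.isHermitian_proj h1.neg (by rw [neg_mul_neg, h2])
      (by rw [neg_mul, h3])
    rw [sub_neg_eq_add] at hP
    have hUt : U.trace = 0 := by
      rw [hU, trace_smul, trace_sum]
      simp [h.trace_eq_zero hg]
    have hpos := h.proj_trace_pos (by omega)
    -- Pairing the unnormalised state `P + U` with `V_ℒ · 1 - t U` gives `(V_ℒ - t) Tr P ≥ 0`.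
    have := reTr_nonneg hP hle
    rw [hM, map_sub, map_smul, map_smul, reTr_one, trace_add, hUt, reTr_comm, map_add,
      reTr_apply U P, reTr_apply U U, h2, h3, hUt, smul_eq_mul, smul_eq_mul, Complex.zero_re,
      add_zero, zero_add, ← sub_mul] at this
    exact sub_nonneg.mp (nonneg_of_mul_nonneg_left this hpos)

/-- Since `-1 ≤ A_x ≤ 1`, setting `x` contributes at most `s_x`. The assemblage `(P ± A_x) / (2 Tr
P)` attains all these bounds simultaneously. -/
theorem quantumValue_eq (h : IsAnticommutingSystem P A) (hg : 1 ≤ g) (hd : 1 ≤ d) {s : Fin g → ℝ} (hs : ∀ x, 0 ≤ s x) :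
    quantumValue (unbiasedFamily (scale s A)) = ∑ x, s x := by
  have hF := isSteeringInequality_unbiasedFamily (h.scale_isHermitian s)
  refine le_antisymm ((quantumValue_le_iff hd hF).mpr fun σ hσ => ?_) ?_
  · rw [value_unbiasedFamily]
    refine Finset.sum_le_sum fun x _ => ?_
    have h1 := reTr_nonneg (hσ.1 x true)
      (one_sub_posSemidef h.isHermitian_proj (h.isHermitian x) (h.mul_self x) (h.mul_proj x))
    have h2 := reTr_nonneg (hσ.1 x false)
      (one_sub_posSemidef h.isHermitian_proj (h.isHermitian x).neg
        (by rw [neg_mul_neg, h.mul_self x]) (by rw [neg_mul, h.mul_proj x]))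
    rw [map_sub, reTr_one] at h1 h2
    rw [map_neg] at h2
    rw [scale, map_smul, smul_eq_mul, map_sub, LinearMap.sub_apply]
    nlinarith [hs x, assemblage_trace hσ x]
  · have hpos := h.proj_trace_pos hg
    set τ := P.trace.re with hτ
    have hPsd : P.PosSemidef := by
      rw [← h.mul_self ⟨0, hg⟩]
      nth_rewrite 2 [← (h.isHermitian ⟨0, hg⟩).eq]
      exact posSemidef_self_mul_conjTranspose _
    have hPt : P.trace = (τ : ℂ) :=
      Complex.ext rfl (Complex.nonneg_iff.mp hPsd.trace_nonneg).2.symm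
    set σ : Family g d := fun x a => (2 * τ)⁻¹ • (P + outcomeSign a • A x) with hσdef
    have hsum : ∀ x, σ x true + σ x false = τ⁻¹ • P := fun x => by
      simp only [hσdef, outcomeSign, if_true, Bool.false_eq_true, if_false, mul_inv]
      module
    have hdiff : ∀ x, σ x true - σ x false = τ⁻¹ • A x := fun x => by
      simp only [hσdef, outcomeSign, if_true, Bool.false_eq_true, if_false, mul_inv]
      module
    have hσ : σ ∈ assemblages g d := by
      refine ⟨fun x a => PosSemidef.smul ?_ (by positivity), fun x => ?_, fun x y => ?_⟩
      · have hm := proj_sub_posSemidef h.isHermitian_proj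
          (isHermitian_realSmul (h.isHermitian x) (-outcomeSign a))
          (by rw [smul_mul_smul_comm, neg_mul_neg, outcomeSign_mul_self, one_smul, h.mul_self])
          (by rw [smul_mul_assoc, h.mul_proj])
        rwa [neg_smul, sub_neg_eq_add] at hm
      · rw [← trace_sum, Fintype.sum_bool, hsum, trace_smul, hPt, Complex.real_smul,
          ← Complex.ofReal_mul, inv_mul_cancel₀ hpos.ne', Complex.ofReal_one]
      · simp only [Fintype.sum_bool, hsum]
    have hv := (quantumValue_le_iff hd hF).mp le_rfl σ hσ
    rw [value_unbiasedFamily] at hv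
    refine le_trans (Finset.sum_le_sum fun x _ => le_of_eq ?_) hv
    rw [hdiff, scale, map_smul, map_smul, LinearMap.smul_apply, reTr_apply, h.mul_self, ← hτ,
      smul_eq_mul, smul_eq_mul, inv_mul_cancel₀ hpos.ne', mul_one]

/-- Anticommuting unitaries confine the steering constants to the unit ball. -/
theorem steeringConstants_subset_quarterBall (h : IsAnticommutingSystem P A) (hg : 2 ≤ g) (hd : 1 ≤ d) :
    steeringConstants g d ⊆ quarterBall g := by
  rintro s ⟨hs, hSig⟩
  refine ⟨hs, ?_⟩
  set t := Real.sqrt (∑ x, s x ^ 2) with ht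
  have hnn : 0 ≤ ∑ x, s x ^ 2 := Finset.sum_nonneg fun x _ => sq_nonneg _
  have htt : t ^ 2 = ∑ x, s x ^ 2 := Real.sq_sqrt hnn
  rcases (Real.sqrt_nonneg (∑ x, s x ^ 2)).eq_or_lt with h0 | h0
  · rw [← htt, ht, ← h0]; norm_num
  rw [← ht] at h0
  -- The weights `s / t` have local value one, and mixing by `s` turns them into `s² / t`, of
  -- quantum value `t² / t = t`; hence `t ≤ 1`.
  have hL : lhsValue (unbiasedFamily (scale (fun x => s x / t) A)) ≤ 1 := by
    rw [h.lhsValue_eq hg hd]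
    simp only [div_pow]
    rw [← Finset.sum_div, ← htt, div_self (by positivity), Real.sqrt_one]
  have hQ := hSig _ (isSteeringInequality_unbiasedFamily (h.scale_isHermitian _)) hL
  have e : scale s (scale (fun x => s x / t) A) = scale (fun x => s x ^ 2 / t) A := by
    ext1 x
    simp only [scale, smul_smul]
    congr 1
    ring
  rw [mixture_unbiasedFamily, e, h.quantumValue_eq (by omega) hd (fun x => by positivity),
    ← Finset.sum_div, ← htt, pow_two, mul_div_cancel_right₀ _ h0.ne'] at hQ
  rw [← htt]
  nlinarith

end IsAnticommutingSystem

end Anticommuting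

/-! ### The Pauli-type system and the largest violation -/

section Main

variable {g d k : ℕ}

theorem isAnticommutingSystem_pauliType (hgk : g ≤ 2 * k + 1) (hkd : 2 ^ k ≤ d) :
    IsAnticommutingSystem (zeroPad d (1 : Matrix (Fin (2 ^ k)) (Fin (2 ^ k)) ℂ))
      (fun x : Fin g => zeroPad d (pauliType k x)) where
  isHermitian x := zeroPad_isHermitian hkd (pauliType_isHermitian k x)
  isHermitian_proj := zeroPad_isHermitian hkd isHermitian_one
  proj_ne_zero h0 := by
    have hk : 0 < 2 ^ k := by positivity
    have := congrFun (congrFun h0 ⟨0, hk.trans_le hkd⟩) ⟨0, hk.trans_le hkd⟩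
    simp [zeroPad] at this
  mul_self x := by rw [zeroPad_mul hkd, pauliType_mul_self]
  anticomm x y hxy := by
    rw [zeroPad_mul hkd, zeroPad_mul hkd, ← zeroPad_neg, pauliType_anticomm
      (fun h => hxy (Fin.ext h)) (x.2.trans_le hgk) (y.2.trans_le hgk)]
  mul_proj x := by rw [zeroPad_mul hkd, mul_one]

theorem IsAnticommutingSystem.violation_eq {P : Matrix (Fin d) (Fin d) ℂ} {A : MatTuple g d}
    (h : IsAnticommutingSystem P A) (hg : 2 ≤ g) (hd : 1 ≤ d) :
    violation (unbiasedFamily A) = Real.sqrt g := by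
  have e : A = scale (fun _ => 1) A := by
    ext1 x
    simp [scale]
  have hg0 : (0 : ℝ) < g := by exact_mod_cast (by omega : 0 < g)
  have hL := h.lhsValue_eq hg hd fun _ => 1
  have hQ := h.quantumValue_eq (by omega) hd (s := fun _ => 1) fun _ => zero_le_one
  rw [← e] at hL hQ
  simp only [one_pow, Finset.sum_const, Finset.card_univ, Fintype.card_fin, nsmul_eq_mul,
    mul_one] at hL hQ
  rw [violation, if_neg, hL, hQ, Real.div_sqrt]
  rw [hQ]
  exact fun h => hg0.ne' h.2

theorem IsAnticommutingSystem.largestUnbiasedViolation_eq {P : Matrix (Fin d) (Fin d) ℂ}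
    {A : MatTuple g d} (h : IsAnticommutingSystem P A) (hg : 2 ≤ g) (hd : 1 ≤ d) :
    largestUnbiasedViolation g d = ((Real.sqrt g : ℝ) : EReal) := by
  refine le_antisymm (iSup₂_le fun F hF => ?_) ?_
  · exact EReal.coe_le_coe_iff.mpr (violation_le (by omega) hd hF.1 hF.2)
  · refine le_iSup₂_of_le (unbiasedFamily A)
      ⟨isSteeringInequality_unbiasedFamily h.isHermitian, fun x => by simp [unbiasedFamily]⟩ ?_
    rw [h.violation_eq hg hd]

end Main

end Steering

theorem mainTheorem5 (g d : ℕ) (hg : 1 ≤ g) (hd : 1 ≤ d) :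
    -- for all `g` and `d`
    (Steering.steeringConstants g d = Steering.cubeInclusionConstants g d ∧
      Steering.quarterBall g ⊆ Steering.steeringConstants g d) ∧
    -- for `g ≥ 2` and `d ≥ 2 ^ ⌈(g - 1) / 2⌉`
    ∀ k : ℕ, k = ⌈((g : ℝ) - 1) / 2⌉₊ → 2 ≤ g → 2 ^ k ≤ d →
      Steering.steeringConstants g d = Steering.quarterBall g ∧
      Steering.cubeInclusionConstants g d = Steering.quarterBall g ∧
      Steering.largestUnbiasedViolation g d = ((Real.sqrt g : ℝ) : EReal) ∧
      -- the Pauli-type matrices are anticommuting self-adjoint unitaries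
      (∀ x : Fin g, (Steering.pauliType k x).IsHermitian) ∧
      (∀ x y : Fin g,
        Steering.pauliType k x * Steering.pauliType k y +
          Steering.pauliType k y * Steering.pauliType k x = if x = y then 2 else 0) ∧
      -- and the steering inequalities built from them have violation `‖s‖₁ / ‖s‖₂`
      ∀ s : Fin g → ℝ, (∀ x, s x ∈ Set.Icc (0 : ℝ) 1) →
        Steering.lhsValue (Steering.unbiasedFamily (Steering.scale s
            (fun x : Fin g => Steering.zeroPad d (Steering.pauliType k x)))) =
          Real.sqrt (∑ x, s x ^ 2) ∧
        Steering.quantumValue (Steering.unbiasedFamily (Steering.scale s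
            (fun x : Fin g => Steering.zeroPad d (Steering.pauliType k x)))) =
          ∑ x, s x := by
  have hEq := Steering.steeringConstants_eq hg hd
  refine ⟨⟨hEq, hEq ▸ Steering.quarterBall_subset_cubeInclusionConstants⟩, ?_⟩
  intro k hk hg2 hkd
  -- The ceiling ensures that all `g` indices fall among the `2k+1` meaningful ones.
  have hgk : g ≤ 2 * k + 1 := by
    have : ((g : ℝ) - 1) / 2 ≤ k := hk ▸ Nat.le_ceil _
    have : (g : ℝ) ≤ 2 * k + 1 := by linarith
    exact_mod_cast this
  have hA := Steering.isAnticommutingSystem_pauliType hgk hkd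
  have hBall : Steering.steeringConstants g d = Steering.quarterBall g :=
    (hA.steeringConstants_subset_quarterBall hg2 hd).antisymm
      (hEq ▸ Steering.quarterBall_subset_cubeInclusionConstants)
  refine ⟨hBall, hEq ▸ hBall, hA.largestUnbiasedViolation_eq hg2 hd,
    fun x => Steering.pauliType_isHermitian k x, fun x y => ?_, fun s hs =>
    ⟨hA.lhsValue_eq hg2 hd s, hA.quantumValue_eq hg hd fun x => (hs x).1⟩⟩
  split_ifs with hxy
  · rw [hxy, Steering.pauliType_mul_self, one_add_one_eq_two]
  · rw [Steering.pauliType_anticomm (fun h => hxy (Fin.ext h)) (x.2.trans_le hgk)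
      (y.2.trans_le hgk), neg_add_cancel]
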